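/- **Setting.** A computable metric space is a complete metric space $(X,d)$ with an enumerated dense sequence of ideal points $\alpha(0),\alpha(1),\dots$ whose distances $d(\alpha(i),\alpha(j))$ are real numbers computable uniformly in $i,j$. It has the enumerated subbasis of open balls $B(\alpha(i),q)$, $q\in\mathbb{Q}$. The set $\mathcal M(X)$ of Borel probability measures on $X$ has the enumerated subbasis of the sets $\{\mu:\int f\,d\mu<r\}$ and $\{\mu:\int f\,d\mu>r\}$, where $r\in\mathbb Q$ and $f$ is a maximum of finitely many hat functions $x\mapsto |1-n|d(x,u)-q|^{+}|^{+}$ ($u$ an ideal point, $q\in\mathbb Q$, $n\ge 1$; $|a|^+=\max(a,0)$). Products have the product subbasis. A family of open sets is uniformly c.e. open if its members are unions, computably enumerable uniformly in the index, of finite intersections of subbasis elements. A map is computable if the preimages of the subbasis elements are uniformly c.e. open; a function $f$ with values in $[0,\infty]$ is lower semicomputable if the sets $\{f>q\}$, $q\in\mathbb Q$, are uniformly c.e. open. A uniform test on $X$ is a lower semicomputable function $(x,\mu)\mapsto f_\mu(x)\in[0,\infty]$ on $X\times\mathcal M(X)$ with $\int f_\mu\,d\mu\le 1$ for all $\mu$.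 It is universal if for every uniform test $g$ there is a constant $c>0$ with $g_\mu(x)\le c f_\mu(x)$ for all $x,\mu$. A computable probability kernel from $X_1$ to $X_0$ is a probability kernel $\Lambda=\{\lambda_x:x\in X_1\}$ for which $x\mapsto\lambda_x$ is a computable map $X_1\to\mathcal M(X_0)$. Write $(\Lambda^*\mu)(B)=\int\lambda_x(B)\,\mu(dx)$, and let $h^*\mu$ be the image of $\mu$ under a map $h$. **Theorem (conservation of randomness).** Let $X_1,X_0$ be computable metric spaces, on each of which a universal uniform test, denoted $\mathbf t_\mu(x)$ in both cases, is fixed, and let $\mathbf d_\mu(x)=\log_2\mathbf t_\mu(x)\in[-\infty,\infty]$ be the deficiency of randomness. 1. For every computable probability kernel $\Lambda$ from $X_1$ to $X_0$ there is a constant $c<\infty$ such that for all $\mu\in\mathcal M(X_1)$ and $x\in X_1$, $$\int \mathbf t_{\Lambda^*\mu}(y)\,\lambda_x(dy)\le c\cdot\mathbf t_\mu(x).$$ 2. For every computable map $h:X_1\to X_0$ there is a constant $c\in\mathbb R$ such that for all $\mu\in\mathcal M(X_1)$ and $x\in X_1$, $$\mathbf d_{h^*\mu}(h(x))\le\mathbf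 d_\mu(x)+c.$$ 3. For every computable probability kernel $\Lambda$ from $X_1$ to $X_0$ there is a constant $c\in\mathbb R$ such that for all $\mu\in\mathcal M(X_1)$, $x\in X_1$ and integers $m>0$, $$\lambda_x\{y:\mathbf d_{\Lambda^*\mu}(y)>\mathbf d_\mu(x)+m+c\}\le 2^{-m}.$$ -/

import Mathlib

open MeasureTheory ProbabilityTheory
open scoped ENNReal NNReal

namespace UniformRandomness

/-! ### Effective subbases, computable maps, lower semicomputable functions -/

/-- Codes of rational numbers: `(a, b, c)` stands for `(a - b) / (c + 1)`. -/
abbrev RatCode : Type := ℕ × ℕ × ℕ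

/-- The rational number with a given code. Every rational number has a code. -/
def ratOf (q : RatCode) : ℚ := ((q.1 : ℚ) - (q.2.1 : ℚ)) / ((q.2.2 : ℚ) + 1)

/-- The finite intersection of subbasic sets given by a list of indices
(the empty list gives the whole space). -/
def basicSet {X ι : Type*} (ν : ι → Set X) (l : List ι) : Set X :=
  {x | ∀ i ∈ l, x ∈ ν i}

/-- An effective topological space is a set `X` with an enumerated subbasis `ν : ι → Set X`
of its topology. A family `U k` of subsets is *uniformly c.e. open* if there is a
computably enumerable set `W` of pairs such that `U k` is the union of the finite intersections
`basicSet ν l` with `(k, l) ∈ W`. -/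
def UniformlyCEOpen {X ι κ : Type*} [Primcodable ι] [Primcodable κ]
    (ν : ι → Set X) (U : κ → Set X) : Prop :=
  ∃ W : κ × List ι → Prop, REPred W ∧ ∀ k, U k = {x | ∃ l, W (k, l) ∧ x ∈ basicSet ν l}

/-- `f` is computable if the preimages of the subbasic sets are uniformly c.e. open. -/
def ComputableMap {X Y ι κ : Type*} [Primcodable ι] [Primcodable κ]
    (ν : ι → Set X) (ν' : κ → Set Y) (f : X → Y) : Prop :=
  UniformlyCEOpen ν (fun j => f ⁻¹' ν' j)

/-- `f` is lower semicomputable if the sets `{x | q < f x}` are c.e. open, uniformly in the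
rational number `q`. -/
def LowerSemicomputable {X ι : Type*} [Primcodable ι] (ν : ι → Set X) (f : X → ℝ≥0∞) : Prop :=
  UniformlyCEOpen ν (fun q : RatCode => {x | (((ratOf q : ℚ) : ℝ) : EReal) < (f x : EReal)})

/-- The subbasis of the product of two effective topological spaces. -/
def prodSubbasis {X Y ι κ : Type*} (ν : ι → Set X) (ν' : κ → Set Y) : ι ⊕ κ → Set (X × Y) :=
  Sum.elim (fun i => Prod.fst ⁻¹' ν i) (fun j => Prod.snd ⁻¹' ν' j)

/-! ### Computable metric spaces and their spaces of probability measures -/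

/-- A computable metric space: a metric space with an enumerated dense set of ideal points
whose distances are computable real numbers, uniformly in the two indices.
(Completeness is a separate class, `CompleteSpace X`.) -/
class ComputableMetricSpace (X : Type*) [MetricSpace X] where
  pt : ℕ → X
  dense_pt : DenseRange pt
  dist_computable : ∃ g : ℕ × ℕ × ℕ → RatCode, Computable g ∧
    ∀ i j n, |dist (pt i) (pt j) - ((ratOf (g (i, j, n)) : ℚ) : ℝ)| < 1 / ((n : ℝ) + 1)

section

variable (X : Type*) [MetricSpace X] [ComputableMetricSpace X]

/-- The enumerated (sub)basis of a computable metric space: the open balls whose centre is an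
ideal point and whose radius is rational. -/
def ballSubbasis : ℕ × RatCode → Set X :=
  fun b => Metric.ball (ComputableMetricSpace.pt b.1) ((ratOf b.2 : ℚ) : ℝ)

variable {X}

/-- The hat function `g_{u,r,ε}(x) = |1 - |d(x,u) - r|⁺ / ε|⁺`, where `u` is an ideal point,
`r` is rational and `ε = 1 / (n + 1)`. -/
noncomputable def hat (p : ℕ × RatCode × ℕ) (x : X) : ℝ :=
  max (1 - max (dist x (ComputableMetricSpace.pt p.1) - ((ratOf p.2.1 : ℚ) : ℝ)) 0
    / (1 / ((p.2.2 : ℝ) + 1))) 0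

/-- Maxima of finitely many hat functions (these are nonnegative; the empty maximum is `0`). -/
noncomputable def maxHat (l : List (ℕ × RatCode × ℕ)) (x : X) : ℝ :=
  l.foldr (fun p v => max (hat p x) v) 0

variable [MeasurableSpace X]

variable (X) in
/-- The enumerated subbasis of the space of probability measures: the sets
`{μ | μ f < r}` and `{μ | μ f > r}` for `f` a maximum of finitely many hat functions and
`r` rational. It generates the weak topology. -/
def measureSubbasis : Bool × List (ℕ × RatCode × ℕ) × RatCode → Set (ProbabilityMeasure X)
  | (true, l, r) => {μ | ∫ x, maxHat l x ∂(μ : Measure X) < ((ratOf r : ℚ) : ℝ)}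
  | (false, l, r) => {μ | ((ratOf r : ℚ) : ℝ) < ∫ x, maxHat l x ∂(μ : Measure X)}

/-! ### Uniform tests and deficiency of randomness -/

/-- A uniform test of randomness: a lower semicomputable function `(x, μ) ↦ t_μ(x)` with
`∫ t_μ dμ ≤ 1` for every probability measure `μ`. -/
def IsUniformTest (t : X × ProbabilityMeasure X → ℝ≥0∞) : Prop :=
  LowerSemicomputable (prodSubbasis (ballSubbasis X) (measureSubbasis X)) t ∧
    ∀ μ : ProbabilityMeasure X, ∫⁻ x, t (x, μ) ∂(μ : Measure X) ≤ 1

/-- A universal uniform test dominates every uniform test up to a multiplicative constant. -/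
def IsUniversalTest (u : X × ProbabilityMeasure X → ℝ≥0∞) : Prop :=
  IsUniformTest u ∧
    ∀ t, IsUniformTest t → ∃ c : ℝ≥0, 0 < c ∧ ∀ x μ, t (x, μ) ≤ (c : ℝ≥0∞) * u (x, μ)

/-- The deficiency of randomness `d_μ(x) = log₂ t_μ(x)`, an extended real number. -/
noncomputable def deficiency (t : X × ProbabilityMeasure X → ℝ≥0∞)
    (μ : ProbabilityMeasure X) (x : X) : EReal :=
  ENNReal.log (t (x, μ)) / ((Real.log 2 : ℝ) : EReal)

end

/-! ### Computable kernels and computable point maps -/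

section

variable {X Y : Type*} [MetricSpace X] [ComputableMetricSpace X]
  [MetricSpace Y] [ComputableMetricSpace Y]

/-- Computable maps between computable metric spaces. -/
def IsComputablePointMap (h : X → Y) : Prop :=
  ComputableMap (ballSubbasis X) (ballSubbasis Y) h

theorem exists_ratOf (q : ℚ) : ∃ c : RatCode, ratOf c = q := by
  refine ⟨(q.num.toNat, (-q.num).toNat, q.den - 1), ?_⟩
  have h1 : ((q.num.toNat : ℚ) - ((-q.num).toNat : ℚ)) = (q.num : ℚ) := by
    exact_mod_cast (show ((q.num.toNat : ℤ) - ((-q.num).toNat : ℤ)) = q.num by omega)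
  have h2 : (((q.den - 1 : ℕ) : ℚ) + 1) = (q.den : ℚ) := by
    exact_mod_cast (show (q.den - 1) + 1 = q.den from Nat.sub_add_cancel q.pos)
  simp only [ratOf, h1, h2]
  exact Rat.num_div_den q

theorem isOpen_basicSet (l : List (ℕ × RatCode)) : IsOpen (basicSet (ballSubbasis X) l) := by
  have h : basicSet (ballSubbasis X) l = ⋂ i ∈ {i | i ∈ l}, ballSubbasis X i := by
    ext x
    simp [basicSet]
  rw [h]
  exact l.finite_toSet.isOpen_biInter fun i _ => Metric.isOpen_ball

theorem IsComputablePointMap.continuous {h : X → Y} (hh : IsComputablePointMap h) :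
    Continuous h := by
  obtain ⟨W, -, hW⟩ := hh
  have hopen : ∀ b, IsOpen (h ⁻¹' ballSubbasis Y b) := by
    intro b
    have e : h ⁻¹' ballSubbasis Y b =
        ⋃ l, ⋃ _ : W (b, l), basicSet (ballSubbasis X) l := by
      rw [show h ⁻¹' ballSubbasis Y b = _ from hW b]
      ext x
      simp
    rw [e]
    exact isOpen_iUnion fun l => isOpen_iUnion fun _ => isOpen_basicSet l
  rw [Metric.continuous_iff']
  intro x ε hε
  obtain ⟨q, hq0, hq⟩ := exists_rat_btwn (half_pos hε)
  obtain ⟨c, rfl⟩ := exists_ratOf q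
  obtain ⟨i, hi⟩ := ComputableMetricSpace.dense_pt (X := Y).exists_dist_lt (h x) hq0
  have hx : x ∈ h ⁻¹' ballSubbasis Y (i, c) := hi
  filter_upwards [(hopen (i, c)).mem_nhds hx] with z hz
  have hz' : dist (h z) (ComputableMetricSpace.pt i) < ((ratOf c : ℚ) : ℝ) := hz
  calc dist (h z) (h x)
      ≤ dist (h z) (ComputableMetricSpace.pt i) + dist (h x) (ComputableMetricSpace.pt i) :=
        dist_triangle_right _ _ _
    _ < ε := by linarith

variable [MeasurableSpace X] [MeasurableSpace Y]

/-- The measure `λ_x`, as a point of the space of probability measures. -/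
def kernelAt (Λ : Kernel X Y) [IsMarkovKernel Λ] (x : X) : ProbabilityMeasure Y :=
  ⟨Λ x, inferInstance⟩

/-- A probability kernel is computable if `x ↦ λ_x` is a computable map into the effective
topological space of probability measures. -/
def IsComputableKernel (Λ : Kernel X Y) [IsMarkovKernel Λ] : Prop :=
  ComputableMap (ballSubbasis X) (measureSubbasis Y) (kernelAt Λ)

/-- The output distribution `Λ*μ`, with `(Λ*μ)(B) = ∫ λ_x(B) μ(dx)`. -/
noncomputable def pushKernel (Λ : Kernel X Y) [IsMarkovKernel Λ] (μ : ProbabilityMeasure X) :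
    ProbabilityMeasure Y :=
  ⟨(μ : Measure X).bind Λ, inferInstance⟩

/-- The image measure `h*μ` under a computable (hence Borel) map `h`. -/
noncomputable def pushMap [BorelSpace X] [BorelSpace Y] (h : X → Y) (hh : IsComputablePointMap h)
    (μ : ProbabilityMeasure X) : ProbabilityMeasure Y :=
  μ.map hh.continuous.measurable.aemeasurable

end

end UniformRandomness

/-!
# Conservation of randomness

Let `Λ` be a computable kernel. The average `T (x, μ) = ∫ t₀ (y, Λ*μ) λ_x(dy)` of the universal test
`t₀` of the target space satisfies `∫ T (x, μ) μ(dx) = ∫ t₀ (y, Λ*μ) (Λ*μ)(dy) ≤ 1`. If `T` is also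
lower semicomputable, then it is a uniform test on the source space
(`IsUniformTest.lintegral_kernel`) and universality of `t₁` gives `T ≤ c t₁`, the first claim. The
second claim is the case `λ_x = δ_{h(x)}` of it, where the kernel is computable because the maxima
of hat functions are computable (`IsComputablePointMap.isComputableKernel_deterministic`). The third
claim follows from the first by Markov's inequality.

The substance is therefore effective: `UniformlyLSC.lintegral` says that
`(μ, z) ↦ ∫ f (x, z) μ(dx)` is lower semicomputable whenever `f` is. It is proved in two steps.

* For `U` c.e. open, `r < μ {x | (x, z) ∈ U}` is a c.e. open condition on `(μ, z)`. It is certified by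
  a finite list of hat functions with `r < ∫ maxHat dμ`, each of whose supports lies inside the ball
  part of some enumerated basic set of `U` whose remaining part contains `z`; the inclusion is
  required *formally*, in terms of centres and radii, to be semidecidable
  (`UniformlyCEOpen.lt_measureReal_section`).
* An integral exceeds `q` if and only if a finite Riemann sum
  `(N + 1)⁻¹ ∑_{j < K} μ {f > (j + 1) / (N + 1)}` does (`lt_lintegral_iff_exists_sum`), and this is
  certified by rational lower bounds of the finitely many measures.

The same fact, applied to the lower semicomputable functions `x ↦ ∫ maxHat l dλ_x` and
`x ↦ ∫ (1 - maxHat l) dλ_x`, shows that `μ ↦ Λ*μ` is a computable map (`computableMap_pushKernel`);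
lower semicomputability of `T` follows by composition with `(x, μ) ↦ (λ_x, Λ*μ)`.

All of this rests on closure properties of recursively enumerable predicates, obtained from the
Kleene normal form, and on the resulting closure properties of uniformly c.e. open families: both
are closed under intersections, unions, existential quantification over a countable index and
universal quantification over a list, and the latter under preimages along computable maps.
-/

/-! ### Closure properties of recursively enumerable predicates -/

section REPredClosure

variable {α β : Type*} [Primcodable α] [Primcodable β]

/-- Kleene normal form. The search bound `n` is a number of computation steps, so that the
matrix `R` can be taken to be monotone in it. -/
theorem REPred.exists_primrecPred {p : α → Prop} (hp : REPred p) :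
    ∃ R : α × ℕ → Prop, PrimrecPred R ∧ (∀ a m n, m ≤ n → R (a, m) → R (a, n)) ∧
      ∀ a, p a ↔ ∃ n, R (a, n) := by
  obtain ⟨c, hc⟩ := Nat.Partrec.Code.exists_code.1 hp
  refine ⟨fun an => (Nat.Partrec.Code.evaln an.2 c (Encodable.encode an.1)).isSome = true,
    ?_, ?_, fun a => ?_⟩
  · refine Primrec.eq.comp (Primrec.option_isSome.comp
      (Nat.Partrec.Code.primrec_evaln.comp
        (.pair (.pair .snd (.const c)) (Primrec.encode.comp .fst)))) (.const true)
  · intro a m n hmn h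
    obtain ⟨x, hx⟩ := Option.isSome_iff_exists.1 h
    exact Option.isSome_iff_exists.2 ⟨x, Nat.Partrec.Code.evaln_mono hmn hx⟩
  · have hev : p a ↔ (Nat.Partrec.Code.eval c (Encodable.encode a)).Dom := by
      rw [hc]
      simp [Part.assert]
    rw [hev, Part.dom_iff_mem]
    simp only [Nat.Partrec.Code.evaln_complete, Option.isSome_iff_exists]
    exact exists_comm

theorem REPred.of_exists_nat {R : α × ℕ → Prop} (hR : PrimrecPred R) :
    REPred fun a => ∃ n, R (a, n) := by
  obtain ⟨_, hR⟩ := hR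
  have h : Partrec fun a => Nat.rfind fun n => (Part.some (decide (R (a, n))) : Part Bool) :=
    Partrec.rfind (p := fun a n => (Part.some (decide (R (a, n))) : Part Bool))
      hR.to_comp.partrec
  refine h.dom_re.of_eq fun a => Nat.rfind_dom.trans ⟨?_, ?_⟩
  · rintro ⟨n, hn, -⟩
    exact ⟨n, of_decide_eq_true (Part.mem_some_iff.1 hn).symm⟩
  · rintro ⟨n, hn⟩
    exact ⟨n, Part.mem_some_iff.2 (decide_eq_true hn).symm, fun _ => trivial⟩

/-- Substitution of a computable function. -/
theorem REPred.comp {p : β → Prop} (hp : REPred p) {f : α → β} (hf : Computable f) :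
    REPred fun a => p (f a) :=
  Partrec.comp (f := fun b => Part.assert (p b) fun _ => Part.some ()) hp hf

theorem PrimrecPred.to_re {p : α → Prop} (hp : PrimrecPred p) : REPred p := by
  obtain ⟨_, hp⟩ := hp
  exact ComputablePred.to_re ⟨_, hp.to_comp⟩

/-- Projection: recursively enumerable predicates are closed under existential quantification. -/
theorem REPred.exists {p : α × β → Prop} (hp : REPred p) : REPred fun a => ∃ b, p (a, b) := by
  obtain ⟨R, hR, -, h⟩ := hp.exists_primrecPred
  have hQ : PrimrecPred fun an : α × ℕ =>
      ∃ b ∈ (Encodable.decode (α := β) an.2.unpair.1).toList, R ((an.1, b), an.2.unpair.2) := by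
    have hrel : PrimrecRel fun (b : β) (an : α × ℕ) => R ((an.1, b), an.2.unpair.2) :=
      hR.comp (.pair (.pair (Primrec.fst.comp .snd) .fst)
        (Primrec.snd.comp (Primrec.unpair.comp (Primrec.snd.comp .snd))))
    exact hrel.exists_mem_list.comp (Primrec.optionToList.comp
      (Primrec.decode.comp (Primrec.fst.comp (Primrec.unpair.comp .snd)))) .id
  refine (REPred.of_exists_nat hQ).of_eq fun a => ⟨?_, ?_⟩
  · rintro ⟨n, b, -, hb⟩
    exact ⟨b, (h _).2 ⟨_, hb⟩⟩
  · rintro ⟨b, hb⟩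
    obtain ⟨n, hn⟩ := (h _).1 hb
    exact ⟨Nat.pair (Encodable.encode b) n, b, by simp, by simpa using hn⟩

theorem REPred.and {p q : α → Prop} (hp : REPred p) (hq : REPred q) :
    REPred fun a => p a ∧ q a := by
  obtain ⟨R, hR, mR, h⟩ := hp.exists_primrecPred
  obtain ⟨S, hS, mS, h'⟩ := hq.exists_primrecPred
  refine (REPred.of_exists_nat (hR.and hS)).of_eq fun a => ?_
  rw [h, h']
  constructor
  · rintro ⟨n, hn, hn'⟩
    exact ⟨⟨n, hn⟩, ⟨n, hn'⟩⟩
  · rintro ⟨⟨m, hm⟩, ⟨n, hn⟩⟩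
    exact ⟨max m n, mR _ _ _ (le_max_left _ _) hm, mS _ _ _ (le_max_right _ _) hn⟩

theorem REPred.or {p q : α → Prop} (hp : REPred p) (hq : REPred q) :
    REPred fun a => p a ∨ q a := by
  obtain ⟨R, hR, -, h⟩ := hp.exists_primrecPred
  obtain ⟨S, hS, -, h'⟩ := hq.exists_primrecPred
  refine (REPred.of_exists_nat (hR.or hS)).of_eq fun a => ?_
  rw [h, h', ← exists_or]

/-- Bounded universal quantification: the monotonicity in the normal form gives a common search
bound for all members of the list. -/
theorem REPred.forall_mem_list {p : α × β → Prop} (hp : REPred p) :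
    REPred fun a : α × List β => ∀ b ∈ a.2, p (a.1, b) := by
  obtain ⟨R, hR, mR, h⟩ := hp.exists_primrecPred
  have hQ : PrimrecPred fun an : (α × List β) × ℕ => ∀ b ∈ an.1.2, R ((an.1.1, b), an.2) := by
    have hrel : PrimrecRel fun (b : β) (an : (α × List β) × ℕ) => R ((an.1.1, b), an.2) :=
      hR.comp (.pair (.pair (Primrec.fst.comp (Primrec.fst.comp .snd)) .fst)
        (Primrec.snd.comp .snd))
    exact hrel.forall_mem_list.comp (Primrec.snd.comp .fst) .id
  refine (REPred.of_exists_nat hQ).of_eq ?_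
  rintro ⟨a, L⟩
  simp only [h]
  constructor
  · rintro ⟨n, hn⟩ b hb
    exact ⟨n, hn b hb⟩
  · intro H
    induction L with
    | nil => exact ⟨0, by simp⟩
    | cons b L ih =>
      obtain ⟨n, hn⟩ := ih fun b' hb' => H b' (List.mem_cons_of_mem _ hb')
      obtain ⟨m, hm⟩ := H b List.mem_cons_self
      refine ⟨max m n, fun b' hb' => ?_⟩
      rcases List.mem_cons.1 hb' with rfl | hb'
      · exact mR _ _ _ (le_max_left _ _) hm
      · exact mR _ _ _ (le_max_right _ _) (hn b' hb')

end REPredClosure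

namespace UniformRandomness

/-! ### Closure properties of uniformly c.e. open families -/

section CEOpenClosure

variable {X Y Z ι κ η θ : Type*} [Primcodable ι] [Primcodable κ] [Primcodable η] [Primcodable θ]
  {ν : ι → Set X}

theorem UniformlyCEOpen.of_eq {U V : κ → Set X} (hU : UniformlyCEOpen ν U)
    (h : ∀ k, U k = V k) : UniformlyCEOpen ν V := by
  rwa [← funext h]

theorem UniformlyCEOpen.reindex {U : κ → Set X} (hU : UniformlyCEOpen ν U) {g : η → κ}
    (hg : Computable g) : UniformlyCEOpen ν fun e => U (g e) := by
  obtain ⟨W, hW, h⟩ := hU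
  exact ⟨fun a => W (g a.1, a.2), hW.comp (.pair (hg.comp .fst) .snd), fun e => h (g e)⟩

theorem uniformlyCEOpen_const {p : κ → Prop} (hp : REPred p) :
    UniformlyCEOpen ν fun k => {_x | p k} :=
  ⟨fun a => p a.1 ∧ a.2 = [], (hp.comp .fst).and
    (PrimrecPred.to_re (Primrec.eq.comp .snd (.const []))),
    fun k => by ext x; simp [basicSet]⟩

theorem uniformlyCEOpen_subbasis : UniformlyCEOpen ν ν :=
  ⟨fun a => a.2 = [a.1], PrimrecPred.to_re
    (Primrec.eq.comp .snd (Primrec.list_cons.comp .fst (.const []))),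
    fun k => by ext x; simp [basicSet]⟩

theorem UniformlyCEOpen.inter {U V : κ → Set X} (hU : UniformlyCEOpen ν U)
    (hV : UniformlyCEOpen ν V) : UniformlyCEOpen ν fun k => {x | x ∈ U k ∧ x ∈ V k} := by
  obtain ⟨W, hW, h⟩ := hU
  obtain ⟨W', hW', h'⟩ := hV
  refine ⟨fun a => ∃ m : List ι × List ι, (W (a.1, m.1) ∧ W' (a.1, m.2)) ∧ a.2 = m.1 ++ m.2,
    ?_, fun k => ?_⟩
  · refine REPred.exists (p := fun b : (κ × List ι) × (List ι × List ι) =>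
      (W (b.1.1, b.2.1) ∧ W' (b.1.1, b.2.2)) ∧ b.1.2 = b.2.1 ++ b.2.2) (.and (.and ?_ ?_) ?_)
    · exact hW.comp (Primrec.to_comp (.pair (Primrec.fst.comp .fst) (Primrec.fst.comp .snd)))
    · exact hW'.comp (Primrec.to_comp (.pair (Primrec.fst.comp .fst) (Primrec.snd.comp .snd)))
    · exact PrimrecPred.to_re (Primrec.eq.comp (Primrec.snd.comp .fst)
        (Primrec.list_append.comp (Primrec.fst.comp .snd) (Primrec.snd.comp .snd)))
  · ext x
    simp only [h, h', Set.mem_ofPred_eq]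
    constructor
    · rintro ⟨⟨l, hl, hx⟩, ⟨l', hl', hx'⟩⟩
      refine ⟨l ++ l', ⟨(l, l'), ⟨hl, hl'⟩, rfl⟩, fun i hi => ?_⟩
      rcases List.mem_append.1 hi with hi | hi
      exacts [hx i hi, hx' i hi]
    · rintro ⟨_, ⟨⟨l, l'⟩, ⟨hl, hl'⟩, rfl⟩, hx⟩
      exact ⟨⟨l, hl, fun i hi => hx i (List.mem_append_left _ hi)⟩,
        ⟨l', hl', fun i hi => hx i (List.mem_append_right _ hi)⟩⟩

theorem UniformlyCEOpen.union {U V : κ → Set X} (hU : UniformlyCEOpen ν U)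
    (hV : UniformlyCEOpen ν V) : UniformlyCEOpen ν fun k => {x | x ∈ U k ∨ x ∈ V k} := by
  obtain ⟨W, hW, h⟩ := hU
  obtain ⟨W', hW', h'⟩ := hV
  refine ⟨fun a => W a ∨ W' a, hW.or hW', fun k => ?_⟩
  ext x
  simp only [h, h', Set.mem_ofPred_eq, or_and_right, exists_or]

theorem UniformlyCEOpen.exists {U : κ × η → Set X} (hU : UniformlyCEOpen ν U) :
    UniformlyCEOpen ν fun k => {x | ∃ e, x ∈ U (k, e)} := by
  obtain ⟨W, hW, h⟩ := hU
  refine ⟨fun a => ∃ e, W ((a.1, e), a.2), REPred.exists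
    (p := fun b : (κ × List ι) × η => W ((b.1.1, b.2), b.1.2))
    (hW.comp (Primrec.to_comp (.pair (.pair (Primrec.fst.comp .fst) .snd)
      (Primrec.snd.comp .fst)))), fun k => ?_⟩
  ext x
  simp only [h, Set.mem_ofPred_eq]
  constructor
  · rintro ⟨e, l, hl, hx⟩
    exact ⟨l, ⟨e, hl⟩, hx⟩
  · rintro ⟨l, ⟨e, hl⟩, hx⟩
    exact ⟨e, l, hl, hx⟩

/-- A finite intersection along a list of indices is enumerated by choosing one basic set for
each member of the list and concatenating them. -/
theorem UniformlyCEOpen.forall_mem_list {U : κ × η → Set X} (hU : UniformlyCEOpen ν U) :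
    UniformlyCEOpen ν fun a : κ × List η => {x | ∀ e ∈ a.2, x ∈ U (a.1, e)} := by
  obtain ⟨W, hW, h⟩ := hU
  refine ⟨fun a => ∃ m : List (η × List ι), (a.1.2 = m.map Prod.fst ∧
    a.2 = (m.map Prod.snd).flatten) ∧ ∀ em ∈ m, W ((a.1.1, em.1), em.2), ?_, ?_⟩
  · refine REPred.exists (p := fun b : ((κ × List η) × List ι) × List (η × List ι) =>
      (b.1.1.2 = b.2.map Prod.fst ∧ b.1.2 = (b.2.map Prod.snd).flatten) ∧
        ∀ em ∈ b.2, W ((b.1.1.1, em.1), em.2)) (.and (PrimrecPred.to_re (.and ?_ ?_)) ?_)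
    · have hmap : Primrec fun m : List (η × List ι) => m.map Prod.fst :=
        Primrec.list_map .id (Primrec.fst.comp Primrec.snd)
      exact Primrec.eq.comp (Primrec.snd.comp (Primrec.fst.comp .fst)) (hmap.comp .snd)
    · have hmap : Primrec fun m : List (η × List ι) => (m.map Prod.snd).flatten :=
        Primrec.list_flatten.comp (Primrec.list_map .id (Primrec.snd.comp Primrec.snd))
      exact Primrec.eq.comp (Primrec.snd.comp .fst) (hmap.comp .snd)
    · have hall : REPred fun a : κ × List (η × List ι) => ∀ em ∈ a.2, W ((a.1, em.1), em.2) :=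
        have hproj : Primrec fun b : κ × (η × List ι) => ((b.1, b.2.1), b.2.2) :=
          .pair (.pair .fst (Primrec.fst.comp .snd)) (Primrec.snd.comp .snd)
        REPred.forall_mem_list (hW.comp hproj.to_comp)
      have hproj : Primrec fun b : ((κ × List η) × List ι) × List (η × List ι) =>
          (b.1.1.1, b.2) := .pair (Primrec.fst.comp (Primrec.fst.comp .fst)) .snd
      have hcomp := hall.comp hproj.to_comp
      exact hcomp
  · rintro ⟨k, L⟩
    ext x
    simp only [h, Set.mem_ofPred_eq]
    constructor
    · intro H
      induction L with
      | nil => exact ⟨[], ⟨[], by simp⟩, by simp [basicSet]⟩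
      | cons e L ih =>
        obtain ⟨l, ⟨m, ⟨rfl, rfl⟩, hm⟩, hx⟩ := ih fun e' he' => H e' (List.mem_cons_of_mem _ he')
        obtain ⟨l, hl, hxl⟩ := H e List.mem_cons_self
        refine ⟨_, ⟨(e, l) :: m, ⟨rfl, rfl⟩, ?_⟩, ?_⟩
        · intro em hem
          rcases List.mem_cons.1 hem with rfl | hem
          exacts [hl, hm _ hem]
        · intro i hi
          rw [List.map_cons, List.flatten_cons, List.mem_append] at hi
          rcases hi with hi | hi
          exacts [hxl i hi, hx i hi]
    · rintro ⟨_, ⟨m, ⟨rfl, rfl⟩, hm⟩, hx⟩ e he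
      obtain ⟨⟨e, l⟩, hem, rfl⟩ := List.mem_map.1 he
      exact ⟨l, hm _ hem, fun i hi => hx i
        (List.mem_flatten.2 ⟨l, List.mem_map.2 ⟨_, hem, rfl⟩, hi⟩)⟩

variable {ν' : η → Set Y} {ν'' : θ → Set Z}

/-- The preimage of a union of finite intersections of subbasic sets is the union of the finite
intersections of their preimages. -/
theorem ComputableMap.preimage {f : X → Y} (hf : ComputableMap ν ν' f) {U : κ → Set Y}
    (hU : UniformlyCEOpen ν' U) : UniformlyCEOpen ν fun k => f ⁻¹' U k := by
  obtain ⟨W, hW, h⟩ := hU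
  have hf' : UniformlyCEOpen ν fun a : κ × η => f ⁻¹' ν' a.2 := hf.reindex .snd
  refine ((uniformlyCEOpen_const hW).inter hf'.forall_mem_list).exists.of_eq fun k => ?_
  ext x
  simp [h, basicSet]

theorem ComputableMap.comp {g : Y → Z} {f : X → Y} (hg : ComputableMap ν' ν'' g)
    (hf : ComputableMap ν ν' f) : ComputableMap ν ν'' (g ∘ f) :=
  hf.preimage hg

theorem computableMap_id : ComputableMap ν ν id :=
  uniformlyCEOpen_subbasis

theorem computableMap_fst : ComputableMap (prodSubbasis ν ν') ν Prod.fst :=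
  (uniformlyCEOpen_subbasis (ν := prodSubbasis ν ν')).reindex Primrec.sumInl.to_comp

theorem computableMap_snd : ComputableMap (prodSubbasis ν ν') ν' Prod.snd :=
  (uniformlyCEOpen_subbasis (ν := prodSubbasis ν ν')).reindex Primrec.sumInr.to_comp

/-- A family indexed by a sum type is uniformly c.e. open if its two halves are. -/
theorem UniformlyCEOpen.sumElim {U : κ → Set X} {V : η → Set X} (hU : UniformlyCEOpen ν U)
    (hV : UniformlyCEOpen ν V) : UniformlyCEOpen ν (Sum.elim U V) := by
  have eL : UniformlyCEOpen ν fun a : (κ ⊕ η) × κ => {_x : X | a.1 = Sum.inl a.2} :=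
    uniformlyCEOpen_const (PrimrecPred.to_re
      (Primrec.eq.comp .fst (Primrec.sumInl.comp .snd)))
  have eR : UniformlyCEOpen ν fun a : (κ ⊕ η) × η => {_x : X | a.1 = Sum.inr a.2} :=
    uniformlyCEOpen_const (PrimrecPred.to_re
      (Primrec.eq.comp .fst (Primrec.sumInr.comp .snd)))
  refine ((eL.inter (hU.reindex .snd)).exists.union
    (eR.inter (hV.reindex .snd)).exists).of_eq ?_
  rintro (k | e) <;> ext x <;> simp

theorem ComputableMap.prodMk {f : X → Y} {g : X → Z} (hf : ComputableMap ν ν' f)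
    (hg : ComputableMap ν ν'' g) :
    ComputableMap ν (prodSubbasis ν' ν'') fun x => (f x, g x) :=
  (UniformlyCEOpen.sumElim hf hg).of_eq (by rintro (j | j) <;> rfl)

end CEOpenClosure

/-! ### Arithmetic on codes of rational numbers -/

section RatCodeArithmetic

/-- Addition on codes. -/
def ratAdd (q r : RatCode) : RatCode :=
  (q.1 * (r.2.2 + 1) + r.1 * (q.2.2 + 1), q.2.1 * (r.2.2 + 1) + r.2.1 * (q.2.2 + 1),
    (q.2.2 + 1) * r.2.2 + q.2.2)

/-- Negation on codes. -/
def ratNeg (q : RatCode) : RatCode := (q.2.1, q.1, q.2.2)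

/-- Division by `n + 1` on codes. -/
def ratDivSucc (q : RatCode) (n : ℕ) : RatCode := (q.1, q.2.1, (q.2.2 + 1) * n + q.2.2)

/-- The sum of a list of codes. -/
def ratSum (l : List RatCode) : RatCode := l.foldr ratAdd (0, 0, 0)

theorem ratOf_ratAdd (q r : RatCode) : ratOf (ratAdd q r) = ratOf q + ratOf r := by
  have h1 : (q.2.2 : ℚ) + 1 ≠ 0 := by positivity
  have h2 : (r.2.2 : ℚ) + 1 ≠ 0 := by positivity
  have h3 : ((q.2.2 : ℚ) + 1) * r.2.2 + q.2.2 + 1 ≠ 0 := by positivity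
  simp only [ratOf, ratAdd]
  push_cast
  field_simp
  ring

theorem ratOf_ratNeg (q : RatCode) : ratOf (ratNeg q) = -ratOf q := by
  simp only [ratOf, ratNeg]
  ring

theorem ratOf_ratDivSucc (q : RatCode) (n : ℕ) : ratOf (ratDivSucc q n) = ratOf q / (n + 1) := by
  have h1 : (q.2.2 : ℚ) + 1 ≠ 0 := by positivity
  have h2 : (n : ℚ) + 1 ≠ 0 := by positivity
  have h3 : ((q.2.2 : ℚ) + 1) * n + q.2.2 + 1 ≠ 0 := by positivity
  simp only [ratOf, ratDivSucc]
  push_cast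
  field_simp
  ring

theorem ratOf_nat_div_succ (m n : ℕ) : ratOf (m, 0, n) = m / (n + 1) := by
  simp [ratOf]

theorem ratOf_nat (m : ℕ) : ratOf (m, 0, 0) = m := by
  simp [ratOf]

theorem ratOf_ratSum (l : List RatCode) : ratOf (ratSum l) = (l.map ratOf).sum := by
  induction l with
  | nil => simp [ratSum, ratOf]
  | cons q l ih =>
    rw [List.map_cons, List.sum_cons, ← ih, ← ratOf_ratAdd]
    rfl

theorem primrec_ratAdd : Primrec₂ ratAdd := by
  have s {f : RatCode × RatCode → ℕ} (hf : Primrec f) : Primrec fun p => f p + 1 :=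
    Primrec.succ.comp hf
  have q1 : Primrec fun p : RatCode × RatCode => p.1.1 := Primrec.fst.comp .fst
  have q2 : Primrec fun p : RatCode × RatCode => p.1.2.1 :=
    Primrec.fst.comp (Primrec.snd.comp .fst)
  have q3 : Primrec fun p : RatCode × RatCode => p.1.2.2 :=
    Primrec.snd.comp (Primrec.snd.comp .fst)
  have r1 : Primrec fun p : RatCode × RatCode => p.2.1 := Primrec.fst.comp .snd
  have r2 : Primrec fun p : RatCode × RatCode => p.2.2.1 :=
    Primrec.fst.comp (Primrec.snd.comp .snd)
  have r3 : Primrec fun p : RatCode × RatCode => p.2.2.2 :=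
    Primrec.snd.comp (Primrec.snd.comp .snd)
  exact Primrec.pair (Primrec.nat_add.comp (Primrec.nat_mul.comp q1 (s r3))
      (Primrec.nat_mul.comp r1 (s q3)))
    (.pair (Primrec.nat_add.comp (Primrec.nat_mul.comp q2 (s r3))
      (Primrec.nat_mul.comp r2 (s q3)))
      (Primrec.nat_add.comp (Primrec.nat_mul.comp (s q3) r3) q3))

theorem primrec_ratNeg : Primrec ratNeg :=
  .pair (Primrec.fst.comp .snd) (.pair .fst (Primrec.snd.comp .snd))

theorem primrec_ratDivSucc : Primrec₂ ratDivSucc := by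
  have q3 : Primrec fun p : RatCode × ℕ => p.1.2.2 :=
    Primrec.snd.comp (Primrec.snd.comp .fst)
  exact Primrec.pair (Primrec.fst.comp .fst) (.pair (Primrec.fst.comp (Primrec.snd.comp .fst))
    (Primrec.nat_add.comp (Primrec.nat_mul.comp (Primrec.succ.comp q3) .snd) q3))

theorem primrec_ratSum : Primrec ratSum :=
  Primrec.list_foldr (h := fun _ p => ratAdd p.1 p.2) .id (.const (0, 0, 0))
    (primrec_ratAdd.comp (Primrec.fst.comp Primrec.snd) (Primrec.snd.comp Primrec.snd))

theorem primrecRel_ratOf_lt : PrimrecRel fun q r : RatCode => ratOf q < ratOf r := by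
  have s {f : RatCode × RatCode → ℕ} (hf : Primrec f) : Primrec fun p => f p + 1 :=
    Primrec.succ.comp hf
  have q1 : Primrec fun p : RatCode × RatCode => p.1.1 := Primrec.fst.comp .fst
  have q2 : Primrec fun p : RatCode × RatCode => p.1.2.1 :=
    Primrec.fst.comp (Primrec.snd.comp .fst)
  have q3 : Primrec fun p : RatCode × RatCode => p.1.2.2 :=
    Primrec.snd.comp (Primrec.snd.comp .fst)
  have r1 : Primrec fun p : RatCode × RatCode => p.2.1 := Primrec.fst.comp .snd
  have r2 : Primrec fun p : RatCode × RatCode => p.2.2.1 :=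
    Primrec.fst.comp (Primrec.snd.comp .snd)
  have r3 : Primrec fun p : RatCode × RatCode => p.2.2.2 :=
    Primrec.snd.comp (Primrec.snd.comp .snd)
  have h := Primrec.nat_lt.comp
    (Primrec.nat_add.comp (Primrec.nat_mul.comp q1 (s r3)) (Primrec.nat_mul.comp r2 (s q3)))
    (Primrec.nat_add.comp (Primrec.nat_mul.comp r1 (s q3)) (Primrec.nat_mul.comp q2 (s r3)))
  refine PrimrecPred.of_eq h fun p => ?_
  simp only [ratOf]
  rw [div_lt_div_iff₀ (by positivity) (by positivity), ← Nat.cast_lt (α := ℚ)]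
  push_cast
  constructor <;> intro h <;> linarith

/-- Comparing the values of two computable expressions is recursively enumerable. -/
theorem rePred_ratOf_lt {α : Type*} [Primcodable α] {f g : α → RatCode} (hf : Computable f)
    (hg : Computable g) : REPred fun a => ratOf (f a) < ratOf (g a) := by
  have h : REPred fun p : RatCode × RatCode => ratOf p.1 < ratOf p.2 :=
    PrimrecPred.to_re primrecRel_ratOf_lt
  have h' := h.comp (hf.pair hg)
  exact h'

theorem exists_ratOf_btwn {a b : ℝ} (h : a < b) :
    ∃ c : RatCode, a < ((ratOf c : ℚ) : ℝ) ∧ ((ratOf c : ℚ) : ℝ) < b := by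
  obtain ⟨q, h1, h2⟩ := exists_rat_btwn h
  obtain ⟨c, rfl⟩ := exists_ratOf q
  exact ⟨c, h1, h2⟩

end RatCodeArithmetic

/-! ### Semidecidable relations between ideal points -/

section IdealPoints

open ComputableMetricSpace

variable (X : Type*) [MetricSpace X] [ComputableMetricSpace X]

/-- A strict inequality for a computable real number is confirmed at some finite precision. -/
theorem rePred_dist_lt :
    REPred fun a : (ℕ × ℕ) × RatCode =>
      dist (pt a.1.1 : X) (pt a.1.2) < ((ratOf a.2 : ℚ) : ℝ) := by
  obtain ⟨g, hg, h⟩ := dist_computable (X := X)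
  have hp : Primrec fun b : ((ℕ × ℕ) × RatCode) × ℕ => (b.1.1.1, b.1.1.2, b.2) :=
    .pair (Primrec.fst.comp (Primrec.fst.comp .fst))
      (.pair (Primrec.snd.comp (Primrec.fst.comp .fst)) .snd)
  have he : Primrec fun b : ((ℕ × ℕ) × RatCode) × ℕ => ((1, 0, b.2) : RatCode) :=
    .pair (.const 1) (.pair (.const 0) .snd)
  have hR : REPred fun b : ((ℕ × ℕ) × RatCode) × ℕ =>
      ratOf (ratAdd (g (b.1.1.1, b.1.1.2, b.2)) (1, 0, b.2)) < ratOf b.1.2 :=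
    rePred_ratOf_lt (primrec_ratAdd.to_comp.comp (hg.comp hp.to_comp) he.to_comp)
      (Computable.snd.comp .fst)
  refine hR.exists.of_eq ?_
  rintro ⟨⟨i, j⟩, q⟩
  simp only [ratOf_ratAdd, ratOf_nat_div_succ]
  constructor
  · rintro ⟨n, hn⟩
    have h1 := (abs_lt.1 (h i j n)).2
    have h2 := (Rat.cast_lt (K := ℝ)).2 hn
    push_cast at h2
    linarith
  · intro hq
    obtain ⟨n, hn⟩ := exists_nat_one_div_lt (half_pos (sub_pos.2 hq))
    refine ⟨n, ?_⟩
    have h1 := (abs_lt.1 (h i j n)).1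
    rw [← Rat.cast_lt (K := ℝ)]
    push_cast
    linarith

theorem rePred_lt_dist :
    REPred fun a : (ℕ × ℕ) × RatCode =>
      ((ratOf a.2 : ℚ) : ℝ) < dist (pt a.1.1 : X) (pt a.1.2) := by
  obtain ⟨g, hg, h⟩ := dist_computable (X := X)
  have hp : Primrec fun b : ((ℕ × ℕ) × RatCode) × ℕ => (b.1.1.1, b.1.1.2, b.2) :=
    .pair (Primrec.fst.comp (Primrec.fst.comp .fst))
      (.pair (Primrec.snd.comp (Primrec.fst.comp .fst)) .snd)
  have he : Primrec fun b : ((ℕ × ℕ) × RatCode) × ℕ => ((1, 0, b.2) : RatCode) :=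
    .pair (.const 1) (.pair (.const 0) .snd)
  have hR : REPred fun b : ((ℕ × ℕ) × RatCode) × ℕ =>
      ratOf (ratAdd b.1.2 (1, 0, b.2)) < ratOf (g (b.1.1.1, b.1.1.2, b.2)) :=
    rePred_ratOf_lt (primrec_ratAdd.to_comp.comp (Computable.snd.comp .fst) he.to_comp)
      (hg.comp hp.to_comp)
  refine hR.exists.of_eq ?_
  rintro ⟨⟨i, j⟩, q⟩
  simp only [ratOf_ratAdd, ratOf_nat_div_succ]
  constructor
  · rintro ⟨n, hn⟩
    have h1 := (abs_lt.1 (h i j n)).1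
    have h2 := (Rat.cast_lt (K := ℝ)).2 hn
    push_cast at h2
    linarith
  · intro hq
    obtain ⟨n, hn⟩ := exists_nat_one_div_lt (half_pos (sub_pos.2 hq))
    refine ⟨n, ?_⟩
    have h1 := (abs_lt.1 (h i j n)).2
    rw [← Rat.cast_lt (K := ℝ)]
    push_cast
    linarith

end IdealPoints

/-! ### Hat functions -/

section Hats

open ComputableMetricSpace

variable {X : Type*} [MetricSpace X] [ComputableMetricSpace X]

theorem hat_le_one (p : ℕ × RatCode × ℕ) (x : X) : hat p x ≤ 1 := by
  refine max_le ?_ zero_le_one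
  have : 0 ≤ max (dist x (pt p.1) - ((ratOf p.2.1 : ℚ) : ℝ)) 0 / (1 / ((p.2.2 : ℝ) + 1)) := by
    positivity
  linarith

/-- A hat function exceeds a level `r` in `[0, 1)` exactly on an open ball. -/
theorem lt_hat_iff (p : ℕ × RatCode × ℕ) (x : X) {r : ℝ} (hr : 0 ≤ r) :
    r < hat p x ↔ r < 1 ∧ dist x (pt p.1) < (ratOf p.2.1 : ℚ) + (1 - r) / ((p.2.2 : ℝ) + 1) := by
  have hn : (0 : ℝ) < (p.2.2 : ℝ) + 1 := by positivity
  rw [hat, lt_max_iff, or_iff_left (not_lt.2 hr), lt_sub_comm, div_div_eq_mul_div, div_one,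
    ← lt_div_iff₀ hn, max_lt_iff, div_pos_iff_of_pos_right hn, sub_pos, sub_lt_iff_lt_add', and_comm]

theorem hat_lt_iff (p : ℕ × RatCode × ℕ) (x : X) {r : ℝ} :
    hat p x < r ↔ 0 < r ∧
      (1 < r ∨ (ratOf p.2.1 : ℚ) + (1 - r) / ((p.2.2 : ℝ) + 1) < dist x (pt p.1)) := by
  have hn : (0 : ℝ) < (p.2.2 : ℝ) + 1 := by positivity
  rw [hat, max_lt_iff, and_comm, sub_lt_comm, div_div_eq_mul_div, div_one, ← div_lt_iff₀ hn,
    lt_max_iff, div_neg_iff, sub_neg, lt_sub_iff_add_lt', or_comm]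
  simp [hn, hn.le.not_gt]

theorem hat_eq_one {p : ℕ × RatCode × ℕ} {x : X} (h : dist x (pt p.1) ≤ (ratOf p.2.1 : ℚ)) :
    hat p x = 1 := by
  simp [hat, max_eq_right (sub_nonpos.2 h)]

theorem continuous_hat (p : ℕ × RatCode × ℕ) : Continuous (hat p : X → ℝ) := by
  unfold hat
  fun_prop

theorem maxHat_nil (x : X) : maxHat [] x = 0 := rfl

theorem maxHat_cons (p : ℕ × RatCode × ℕ) (l : List (ℕ × RatCode × ℕ)) (x : X) :
    maxHat (p :: l) x = max (hat p x) (maxHat l x) := rfl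

theorem maxHat_nonneg (l : List (ℕ × RatCode × ℕ)) (x : X) : 0 ≤ maxHat l x := by
  induction l with
  | nil => exact le_rfl
  | cons p l ih => exact ih.trans (le_max_right _ _)

theorem maxHat_le_one (l : List (ℕ × RatCode × ℕ)) (x : X) : maxHat l x ≤ 1 := by
  induction l with
  | nil => exact zero_le_one
  | cons p l ih => exact max_le (hat_le_one p x) ih

theorem continuous_maxHat (l : List (ℕ × RatCode × ℕ)) : Continuous (maxHat l : X → ℝ) := by
  induction l with
  | nil => exact continuous_const
  | cons p l ih => exact (continuous_hat p).max ih

theorem lt_maxHat_iff (l : List (ℕ × RatCode × ℕ)) (x : X) {r : ℝ} (hr : 0 ≤ r) :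
    r < maxHat l x ↔ ∃ p ∈ l, r < hat p x := by
  induction l with
  | nil => simp [maxHat_nil, hr]
  | cons p l ih => simp [maxHat_cons, ih]

theorem maxHat_lt_iff (l : List (ℕ × RatCode × ℕ)) (x : X) {r : ℝ} :
    maxHat l x < r ↔ 0 < r ∧ ∀ p ∈ l, hat p x < r := by
  induction l with
  | nil => simp [maxHat_nil]
  | cons p l ih => simp [maxHat_cons, ih, and_left_comm]

theorem hat_le_maxHat {l : List (ℕ × RatCode × ℕ)} {p : ℕ × RatCode × ℕ} (hp : p ∈ l) (x : X) :
    hat p x ≤ maxHat l x := by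
  induction l with
  | nil => simp at hp
  | cons p' l ih =>
    rcases List.mem_cons.1 hp with rfl | hp
    · exact le_max_left _ _
    · exact (ih hp).trans (le_max_right _ _)

/-- The support of the hat function with index `p` lies *formally* inside the ball with index
`b`: the inclusion is witnessed by the centres and the radii, hence is semidecidable. -/
def HatInBall (X : Type*) [MetricSpace X] [ComputableMetricSpace X] (p : ℕ × RatCode × ℕ)
    (b : ℕ × RatCode) : Prop :=
  dist (pt p.1 : X) (pt b.1) + ((ratOf p.2.1 : ℚ) : ℝ) + 1 / ((p.2.2 : ℝ) + 1) < (ratOf b.2 : ℚ)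

theorem HatInBall.mem {p : ℕ × RatCode × ℕ} {b : ℕ × RatCode} (h : HatInBall X p b) {x : X}
    (hx : 0 < hat p x) : x ∈ ballSubbasis X b := by
  have h1 := ((lt_hat_iff p x le_rfl).1 hx).2
  rw [sub_zero] at h1
  unfold HatInBall at h
  have h2 := dist_triangle x (pt p.1 : X) (pt b.1)
  change dist x (pt b.1) < _
  linarith

theorem rePred_hatInBall :
    REPred fun a : (ℕ × RatCode × ℕ) × (ℕ × RatCode) => HatInBall X a.1 a.2 := by
  have hi : Primrec fun a : (ℕ × RatCode × ℕ) × (ℕ × RatCode) => (a.1.1, a.2.1) :=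
    .pair (Primrec.fst.comp .fst) (Primrec.fst.comp .snd)
  have hr : Primrec fun a : (ℕ × RatCode × ℕ) × (ℕ × RatCode) => a.1.2.1 :=
    Primrec.fst.comp (Primrec.snd.comp .fst)
  have hn : Primrec fun a : (ℕ × RatCode × ℕ) × (ℕ × RatCode) => ((1, 0, a.1.2.2) : RatCode) :=
    .pair (.const 1) (.pair (.const 0) (Primrec.snd.comp (Primrec.snd.comp .fst)))
  have hq := primrec_ratAdd.comp (Primrec.snd.comp .snd)
    (primrec_ratNeg.comp (primrec_ratAdd.comp hr hn))
  refine ((rePred_dist_lt X).comp (hi.pair hq).to_comp).of_eq fun a => ?_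
  simp only [ratOf_ratAdd, ratOf_ratNeg, ratOf_nat_div_succ, HatInBall]
  push_cast
  constructor <;> intro h <;> linarith

/-- Around each point of a finite intersection of balls some hat function takes the value one and
has its support formally inside each of the balls. -/
theorem exists_hatInBall (x : X) (l : List (ℕ × RatCode)) (hx : x ∈ basicSet (ballSubbasis X) l) :
    ∃ p, hat p x = 1 ∧ ∀ b ∈ l, HatInBall X p b := by
  obtain ⟨δ, hδ, h⟩ : ∃ δ > 0, ∀ b ∈ l, dist x (pt b.1) + δ ≤ ((ratOf b.2 : ℚ) : ℝ) := by
    induction l with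
    | nil => exact ⟨1, one_pos, by simp⟩
    | cons b l ih =>
      obtain ⟨δ, hδ, h⟩ := ih fun b' hb' => hx b' (List.mem_cons_of_mem _ hb')
      have hb : dist x (pt b.1) < ((ratOf b.2 : ℚ) : ℝ) := hx b List.mem_cons_self
      refine ⟨min δ (((ratOf b.2 : ℚ) : ℝ) - dist x (pt b.1)), lt_min hδ (sub_pos.2 hb), ?_⟩
      intro b' hb'
      rcases List.mem_cons.1 hb' with rfl | hb'
      · linarith [min_le_right δ (((ratOf b'.2 : ℚ) : ℝ) - dist x (pt b'.1))]
      · linarith [h b' hb', min_le_left δ (((ratOf b.2 : ℚ) : ℝ) - dist x (pt b.1))]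
  have hδ3 : 0 < δ / 3 := by positivity
  obtain ⟨n, hn⟩ := exists_nat_one_div_lt hδ3
  obtain ⟨i, hi⟩ := (dense_pt (X := X)).exists_dist_lt x hδ3
  obtain ⟨c, hc, hc'⟩ := exists_ratOf_btwn hi
  refine ⟨(i, c, n), hat_eq_one hc.le, fun b hb => ?_⟩
  have h1 := h b hb
  have h2 := dist_triangle_left (pt i : X) (pt b.1) x
  change dist (pt i : X) (pt b.1) + ((ratOf c : ℚ) : ℝ) + 1 / ((n : ℝ) + 1) < _
  linarith

end Hats

/-! ### Measures of c.e. open sets -/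

section MeasureOfOpen

open ComputableMetricSpace Filter
open scoped Topology

variable {X : Type*} [MetricSpace X] [ComputableMetricSpace X] [MeasurableSpace X] [BorelSpace X]

theorem integrable_maxHat (μ : Measure X) [IsFiniteMeasure μ] (l : List (ℕ × RatCode × ℕ)) :
    Integrable (maxHat l) μ :=
  Integrable.of_bound (continuous_maxHat l).aestronglyMeasurable 1 <|
    .of_forall fun x => by
      rw [Real.norm_of_nonneg (maxHat_nonneg l x)]
      exact maxHat_le_one l x

/-- The measure of a set that is exhausted from inside by hat functions is the supremum of the
integrals of the finite maxima of these functions. -/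
theorem lt_measureReal_iff_exists_maxHat (μ : Measure X) [IsFiniteMeasure μ] {S : Set X}
    {H : Set (ℕ × RatCode × ℕ)} (hS : ∀ x ∈ S, ∃ p ∈ H, hat p x = 1)
    (hH : ∀ p ∈ H, ∀ x, 0 < hat p x → x ∈ S) (r : ℝ) :
    r < μ.real S ↔ ∃ l : List (ℕ × RatCode × ℕ), (∀ p ∈ l, p ∈ H) ∧ r < ∫ x, maxHat l x ∂μ := by
  have hSm : MeasurableSet S := by
    have e : S = ⋃ p ∈ H, {x | 0 < hat p x} := by
      ext x
      simp only [Set.mem_iUnion, exists_prop, Set.mem_ofPred_eq]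
      refine ⟨fun hx => ?_, fun ⟨p, hp, hx⟩ => hH p hp x hx⟩
      obtain ⟨p, hp, h1⟩ := hS x hx
      exact ⟨p, hp, h1 ▸ one_pos⟩
    rw [e]
    exact (isOpen_biUnion fun p _ => isOpen_lt continuous_const (continuous_hat p)).measurableSet
  have hout {l : List (ℕ × RatCode × ℕ)} (hl : ∀ p ∈ l, p ∈ H) {x : X} (hx : x ∉ S) :
      maxHat l x = 0 := by
    refine le_antisymm (not_lt.1 fun h => hx ?_) (maxHat_nonneg l x)
    obtain ⟨p, hp, h⟩ := (lt_maxHat_iff l x le_rfl).1 h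
    exact hH p (hl p hp) x h
  have hint : ∫ x, S.indicator (fun _ => (1 : ℝ)) x ∂μ = μ.real S := by
    rw [integral_indicator hSm]
    simp
  constructor
  · classical
    intro hr
    -- the lists of the members of `H` among the first `N` indices
    let l : ℕ → List (ℕ × RatCode × ℕ) := fun N =>
      ((List.range N).filterMap Encodable.decode).filter (· ∈ H)
    have hl : ∀ N, ∀ p ∈ l N, p ∈ H := fun N p hp => by simpa using (List.mem_filter.1 hp).2
    have hlim : Tendsto (fun N => ∫ x, maxHat (l N) x ∂μ) atTop (𝓝 (μ.real S)) := by
      rw [← hint]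
      refine tendsto_integral_of_dominated_convergence (fun _ => 1)
        (fun N => (continuous_maxHat _).aestronglyMeasurable) (integrable_const 1)
        (fun N => .of_forall fun x => ?_) (.of_forall fun x => ?_)
      · rw [Real.norm_of_nonneg (maxHat_nonneg _ x)]
        exact maxHat_le_one _ x
      · refine tendsto_const_nhds.congr' ?_
        by_cases hx : x ∈ S
        · obtain ⟨p, hp, h1⟩ := hS x hx
          filter_upwards [eventually_gt_atTop (Encodable.encode p)] with N hN
          have hmem : p ∈ l N := List.mem_filter.2
            ⟨List.mem_filterMap.2 ⟨_, List.mem_range.2 hN, Encodable.encodek p⟩, by simpa using hp⟩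
          rw [Set.indicator_of_mem hx]
          exact le_antisymm (h1 ▸ hat_le_maxHat hmem x) (maxHat_le_one _ x)
        · refine .of_forall fun N => ?_
          rw [Set.indicator_of_notMem hx]
          exact (hout (hl N) hx).symm
    obtain ⟨N, hN⟩ := (hlim.eventually (lt_mem_nhds hr)).exists
    exact ⟨l N, hl N, hN⟩
  · rintro ⟨l, hl, hr⟩
    refine hr.trans_le ?_
    rw [← hint]
    refine integral_mono (integrable_maxHat μ l) ((integrable_const 1).indicator hSm) fun x => ?_
    by_cases hx : x ∈ S
    · rw [Set.indicator_of_mem hx]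
      exact maxHat_le_one l x
    · rw [Set.indicator_of_notMem hx, hout hl hx]

variable {Z ι κ : Type*} [Primcodable ι] [Primcodable κ] {ν : ι → Set Z}

theorem UniformlyCEOpen.isOpen_section {Y : Type*} [MetricSpace Y] [ComputableMetricSpace Y]
    {U : κ → Set (Y × Z)}
    (hU : UniformlyCEOpen (prodSubbasis (ballSubbasis Y) ν) U) (k : κ) (z : Z) :
    IsOpen {x | (x, z) ∈ U k} := by
  obtain ⟨W, -, h⟩ := hU
  have e : {x | (x, z) ∈ U k} = ⋃ l ∈ {l | W (k, l)}, ⋂ i ∈ {i | i ∈ l},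
      {x | (x, z) ∈ prodSubbasis (ballSubbasis Y) ν i} := by
    ext x
    simp only [h, basicSet, Set.mem_ofPred_eq, Set.mem_iUnion, Set.mem_iInter, exists_prop]
  rw [e]
  refine isOpen_biUnion fun l _ => l.finite_toSet.isOpen_biInter fun i _ => ?_
  rcases i with b | j
  · exact Metric.isOpen_ball
  · exact isOpen_const (p := z ∈ ν j)

/-- The measure of the section of a c.e. open set is lower semicomputable in the measure and the
parameter: a lower bound is certified by finitely many hat functions, each of them formally inside
the ball part of some enumerated basic set whose remaining part contains the parameter. -/
theorem UniformlyCEOpen.lt_measureReal_section {U : κ → Set (X × Z)}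
    (hU : UniformlyCEOpen (prodSubbasis (ballSubbasis X) ν) U) :
    UniformlyCEOpen (prodSubbasis (measureSubbasis X) ν) fun a : κ × RatCode =>
      {p : ProbabilityMeasure X × Z |
        ((ratOf a.2 : ℚ) : ℝ) < (p.1 : Measure X).real {x | (x, p.2) ∈ U a.1}} := by
  obtain ⟨W, hW, h⟩ := hU
  -- the hat functions certified to lie inside the section of `U k` at `z`
  let H : κ → Z → Set (ℕ × RatCode × ℕ) := fun k z =>
    {p | ∃ l, W (k, l) ∧ ∀ i ∈ l, (∃ b, i = Sum.inl b ∧ HatInBall X p b) ∨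
      ∃ j, i = Sum.inr j ∧ z ∈ ν j}
  -- `i` is the index of a ball that formally contains the support of the hat function
  have hball : UniformlyCEOpen (prodSubbasis (measureSubbasis X) ν)
      fun a : (κ × (ℕ × RatCode × ℕ)) × ((ℕ × RatCode) ⊕ ι) =>
        {_q | ∃ b, a.2 = Sum.inl b ∧ HatInBall X a.1.2 b} := by
    refine uniformlyCEOpen_const (REPred.exists (p :=
      fun c : ((κ × (ℕ × RatCode × ℕ)) × ((ℕ × RatCode) ⊕ ι)) × (ℕ × RatCode) =>
        c.1.2 = Sum.inl c.2 ∧ HatInBall X c.1.1.2 c.2) (.and ?_ ?_))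
    · exact PrimrecPred.to_re (Primrec.eq.comp (Primrec.snd.comp .fst)
        (Primrec.sumInl.comp .snd))
    · have hp : Primrec fun c : ((κ × (ℕ × RatCode × ℕ)) × ((ℕ × RatCode) ⊕ ι)) × (ℕ × RatCode) =>
          (c.1.1.2, c.2) := .pair (Primrec.snd.comp (Primrec.fst.comp .fst)) .snd
      have hc := (rePred_hatInBall (X := X)).comp hp.to_comp
      exact hc
  -- `i` is the index of a subbasic set that contains the parameter
  have hpar : UniformlyCEOpen (prodSubbasis (measureSubbasis X) ν)
      fun a : (κ × (ℕ × RatCode × ℕ)) × ((ℕ × RatCode) ⊕ ι) =>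
        {q | ∃ j, a.2 = Sum.inr j ∧ q.2 ∈ ν j} := by
    have h1 : UniformlyCEOpen (prodSubbasis (measureSubbasis X) ν)
        fun c : ((κ × (ℕ × RatCode × ℕ)) × ((ℕ × RatCode) ⊕ ι)) × ι =>
          {_q | c.1.2 = Sum.inr c.2} :=
      uniformlyCEOpen_const (PrimrecPred.to_re (Primrec.eq.comp (Primrec.snd.comp .fst)
        (Primrec.sumInr.comp .snd)))
    have h2 : UniformlyCEOpen (prodSubbasis (measureSubbasis X) ν)
        fun c : ((κ × (ℕ × RatCode × ℕ)) × ((ℕ × RatCode) ⊕ ι)) × ι => Prod.snd ⁻¹' ν c.2 :=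
      (computableMap_snd (ν := measureSubbasis X) (ν' := ν)).reindex .snd
    exact (h1.inter h2).exists
  have hHopen : UniformlyCEOpen (prodSubbasis (measureSubbasis X) ν)
      fun a : κ × (ℕ × RatCode × ℕ) => {q | a.2 ∈ H a.1 q.2} := by
    have hp : Primrec fun c : (κ × (ℕ × RatCode × ℕ)) × List ((ℕ × RatCode) ⊕ ι) =>
        (c.1.1, c.2) := .pair (Primrec.fst.comp .fst) .snd
    have hW' : REPred fun c : (κ × (ℕ × RatCode × ℕ)) × List ((ℕ × RatCode) ⊕ ι) =>
        W (c.1.1, c.2) := hW.comp hp.to_comp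
    exact ((uniformlyCEOpen_const hW').inter (hball.union hpar).forall_mem_list).exists
  have hmeas : UniformlyCEOpen (prodSubbasis (measureSubbasis X) ν)
      fun c : (κ × RatCode) × List (ℕ × RatCode × ℕ) =>
        prodSubbasis (measureSubbasis X) ν (Sum.inl (false, c.2, c.1.2)) := by
    have hp : Primrec fun c : (κ × RatCode) × List (ℕ × RatCode × ℕ) =>
        (Sum.inl (false, c.2, c.1.2) : (Bool × List (ℕ × RatCode × ℕ) × RatCode) ⊕ ι) :=
      Primrec.sumInl.comp (.pair (.const false) (.pair .snd (Primrec.snd.comp .fst)))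
    exact uniformlyCEOpen_subbasis.reindex hp.to_comp
  have hall : UniformlyCEOpen (prodSubbasis (measureSubbasis X) ν)
      fun c : (κ × RatCode) × List (ℕ × RatCode × ℕ) => {q | ∀ p ∈ c.2, p ∈ H c.1.1 q.2} := by
    have hp : Primrec fun c : (κ × RatCode) × List (ℕ × RatCode × ℕ) => (c.1.1, c.2) :=
      .pair (Primrec.fst.comp .fst) .snd
    exact hHopen.forall_mem_list.reindex hp.to_comp
  refine (hall.inter hmeas).exists.of_eq ?_
  rintro ⟨k, r⟩
  ext ⟨μ, z⟩
  have hint (l : List (ℕ × RatCode × ℕ)) :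
      ((μ, z) ∈ prodSubbasis (measureSubbasis X) ν (Sum.inl (false, l, r))) ↔
        ((ratOf r : ℚ) : ℝ) < ∫ x, maxHat l x ∂(μ : Measure X) := Iff.rfl
  simp only [Set.mem_ofPred_eq, hint]
  refine (lt_measureReal_iff_exists_maxHat (μ : Measure X) (S := {x | (x, z) ∈ U k}) (H := H k z)
    ?_ ?_ _).symm
  · intro x hx
    rw [Set.mem_ofPred_eq, h] at hx
    obtain ⟨l, hl, hx⟩ := hx
    obtain ⟨p, hp, hpl⟩ := exists_hatInBall x (l.filterMap Sum.getLeft?) (by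
      intro b hb
      obtain ⟨i, hi, hib⟩ := List.mem_filterMap.1 hb
      rw [Sum.getLeft?_eq_some_iff] at hib
      subst hib
      exact hx _ hi)
    refine ⟨p, ⟨l, hl, fun i hi => ?_⟩, hp⟩
    rcases i with b | j
    · exact .inl ⟨b, rfl, hpl b (List.mem_filterMap.2 ⟨_, hi, rfl⟩)⟩
    · exact .inr ⟨j, rfl, hx _ hi⟩
  · rintro p ⟨l, hl, hp⟩ x hx
    rw [Set.mem_ofPred_eq, h]
    refine ⟨l, hl, fun i hi => ?_⟩
    rcases hp i hi with ⟨b, rfl, hb⟩ | ⟨j, rfl, hj⟩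
    · exact hb.mem hx
    · exact hj

end MeasureOfOpen

/-! ### Integrals of lower semicomputable functions -/

section Integral

open Filter
open scoped Topology

/-- Counting the thresholds `1, …, K` below `t` never exceeds `t`. -/
theorem sum_range_ite_lt_le (t : ℝ≥0∞) (K : ℕ) :
    ∑ j ∈ Finset.range K, (if (j : ℝ≥0∞) + 1 < t then (1 : ℝ≥0∞) else 0) ≤ t := by
  induction K with
  | zero => simp
  | succ K ih =>
    rw [Finset.sum_range_succ]
    split_ifs with h
    · refine le_trans ?_ h.le
      gcongr
      calc _ ≤ ∑ j ∈ Finset.range K, (1 : ℝ≥0∞) :=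
            Finset.sum_le_sum fun j _ => by split_ifs <;> simp
        _ = K := by simp
    · simpa using ih

/-- Counting the thresholds `1, …, K` below `t` determines `t`, truncated at `K`, up to an error of
at most one. -/
theorem min_le_sum_range_ite_lt (t : ℝ≥0∞) (K : ℕ) :
    min t K ≤ ∑ j ∈ Finset.range K, (if (j : ℝ≥0∞) + 1 < t then (1 : ℝ≥0∞) else 0) + 1 := by
  induction K with
  | zero => simp
  | succ K ih =>
    by_cases h : (K : ℝ≥0∞) < t
    · have hK : ∑ j ∈ Finset.range K, (if (j : ℝ≥0∞) + 1 < t then (1 : ℝ≥0∞) else 0) = K := by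
        rw [Finset.sum_congr rfl fun j hj => if_pos ?_]
        · simp
        · refine lt_of_le_of_lt ?_ h
          exact_mod_cast Finset.mem_range.1 hj
      rw [Finset.sum_range_succ, hK]
      refine (min_le_right _ _).trans ?_
      push_cast
      gcongr
      exact le_self_add
    · have ht := not_lt.1 h
      rw [min_eq_left ht] at ih
      refine (min_le_left _ _).trans (ih.trans ?_)
      gcongr
      exact K.le_succ

variable {X : Type*} [MeasurableSpace X]

/-- An integral exceeds `q` if and only if some finite Riemann sum over the superlevel sets of the
integrand does. -/
theorem lt_lintegral_iff_exists_sum (μ : Measure X) [IsProbabilityMeasure μ] {f : X → ℝ≥0∞}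
    (hf : Measurable f) {q : ℝ} (hq : 0 ≤ q) :
    ENNReal.ofReal q < ∫⁻ x, f x ∂μ ↔ ∃ N K : ℕ,
      q < (∑ j ∈ Finset.range K,
        μ.real {x | ENNReal.ofReal (((j : ℝ) + 1) / ((N : ℝ) + 1)) < f x}) / ((N : ℝ) + 1) := by
  have hN0 (N : ℕ) : ((N : ℝ≥0∞) + 1) ≠ 0 := by simp
  have hNt (N : ℕ) : ((N : ℝ≥0∞) + 1) ≠ ⊤ := by simp
  have hthr (N j : ℕ) (x : X) : ENNReal.ofReal (((j : ℝ) + 1) / ((N : ℝ) + 1)) < f x ↔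
      (j : ℝ≥0∞) + 1 < f x * ((N : ℝ≥0∞) + 1) := by
    rw [ENNReal.ofReal_div_of_pos (by positivity), ENNReal.div_lt_iff (.inl ?_) (.inl ?_),
      ENNReal.ofReal_add (by positivity) zero_le_one, ENNReal.ofReal_add (by positivity) zero_le_one,
      ENNReal.ofReal_natCast, ENNReal.ofReal_natCast, ENNReal.ofReal_one]
    · simp; positivity
    · simp
  -- the integral of the step function counting thresholds
  have hsum (N K : ℕ) : ENNReal.ofReal ((∑ j ∈ Finset.range K,
        μ.real {x | ENNReal.ofReal (((j : ℝ) + 1) / ((N : ℝ) + 1)) < f x}) / ((N : ℝ) + 1)) =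
      (∫⁻ x, ∑ j ∈ Finset.range K,
        (if (j : ℝ≥0∞) + 1 < f x * ((N : ℝ≥0∞) + 1) then (1 : ℝ≥0∞) else 0) ∂μ) /
          ((N : ℝ≥0∞) + 1) := by
    have hm (j : ℕ) : MeasurableSet {x | (j : ℝ≥0∞) + 1 < f x * ((N : ℝ≥0∞) + 1)} :=
      measurableSet_lt measurable_const (hf.mul_const _)
    rw [lintegral_finsetSum _ fun j _ => Measurable.ite (hm j) measurable_const measurable_const,
      ENNReal.ofReal_div_of_pos (by positivity), ENNReal.ofReal_sum_of_nonneg fun _ _ => by positivity,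
      ENNReal.ofReal_add (by positivity) zero_le_one, ENNReal.ofReal_natCast, ENNReal.ofReal_one]
    congr 1
    refine Finset.sum_congr rfl fun j _ => ?_
    simp only [hthr]
    rw [ofReal_measureReal, ← lintegral_indicator_one (hm j)]
    refine lintegral_congr fun x => ?_
    simp [Set.indicator_apply]
  constructor
  · intro h
    -- truncate the integrand at a level that loses less than the available slack
    have hmono : Monotone fun (M : ℕ) (x : X) => min (f x) ((M : ℝ≥0∞) + 1) := by
      intro M M' hM x
      dsimp only
      gcongr
    have hsup : ∀ x, ⨆ M : ℕ, min (f x) ((M : ℝ≥0∞) + 1) = f x := by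
      intro x
      refine le_antisymm (iSup_le fun _ => min_le_left _ _) (le_of_forall_lt fun c hc => ?_)
      obtain ⟨M, hM⟩ := ENNReal.exists_nat_gt hc.ne_top
      exact (lt_min hc (hM.trans_le le_self_add)).trans_le
        (le_iSup (fun M : ℕ => min (f x) ((M : ℝ≥0∞) + 1)) M)
    rw [← lintegral_congr hsup,
      lintegral_iSup (fun M => hf.min measurable_const) hmono, lt_iSup_iff] at h
    obtain ⟨M, hM⟩ := h
    obtain ⟨c, hc, hcM⟩ := exists_between hM
    obtain ⟨n, hn⟩ := ENNReal.exists_inv_nat_lt (tsub_pos_of_lt hc).ne'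
    set N := max M n with hNdef
    have hbound : ∫⁻ x, min (f x) ((M : ℝ≥0∞) + 1) ∂μ ≤
        (∫⁻ x, ∑ j ∈ Finset.range ((N + 1) * (N + 1)),
          (if (j : ℝ≥0∞) + 1 < f x * ((N : ℝ≥0∞) + 1) then (1 : ℝ≥0∞) else 0) ∂μ) /
            ((N : ℝ≥0∞) + 1) + ((N : ℝ≥0∞) + 1)⁻¹ := by
      rw [← one_div, ENNReal.div_add_div_same,
        ENNReal.le_div_iff_mul_le (.inl (hN0 N)) (.inl (hNt N)),
        ← lintegral_mul_const' _ _ (hNt N)]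
      have hadd (g : X → ℝ≥0∞) : ∫⁻ x, g x ∂μ + 1 = ∫⁻ x, (g x + 1) ∂μ := by
        rw [lintegral_add_right _ measurable_const]
        simp
      rw [hadd]
      refine lintegral_mono fun x => ?_
      refine le_trans ?_ (min_le_sum_range_ite_lt _ _)
      rw [min_mul_of_nonneg _ _ (zero_le), Nat.cast_mul]
      push_cast
      gcongr
      exact le_max_left _ _
    refine ⟨N, (N + 1) * (N + 1), ?_⟩
    have hnN : ((N : ℝ≥0∞) + 1)⁻¹ ≤ (n : ℝ≥0∞)⁻¹ := by
      rw [ENNReal.inv_le_inv]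
      refine le_trans ?_ le_self_add
      exact_mod_cast le_max_right M n
    have hlt : ENNReal.ofReal q + ((N : ℝ≥0∞) + 1)⁻¹ < _ :=
      lt_of_lt_of_le (lt_of_le_of_lt (add_le_add_right hnN _)
        (lt_of_lt_of_le (lt_tsub_iff_left.1 hn) hcM.le)) hbound
    have hfin := lt_of_add_lt_add_right hlt
    rw [← hsum] at hfin
    exact (ENNReal.ofReal_lt_ofReal_iff_of_nonneg hq).1 hfin
  · rintro ⟨N, K, h⟩
    rw [← ENNReal.ofReal_lt_ofReal_iff_of_nonneg hq, hsum] at h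
    refine h.trans_le ?_
    rw [ENNReal.div_le_iff (hN0 N) (hNt N), ← lintegral_mul_const' _ _ (hNt N)]
    exact lintegral_mono fun x => sum_range_ite_lt_le _ _

/-- A finite sum exceeds `q` if and only if it does so after replacing its terms by smaller rational
numbers. The list carries the positions of its members, which makes it self-describing. -/
theorem lt_sum_range_iff_exists_list (m : ℕ → ℝ) (N : ℕ) (q : ℝ) :
    (∃ K : ℕ, q < (∑ j ∈ Finset.range K, m j) / ((N : ℝ) + 1)) ↔
      ∃ L : List (ℕ × RatCode), (L.map Prod.fst = List.range L.length ∧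
        q < ((ratOf (ratDivSucc (ratSum (L.map Prod.snd)) N) : ℚ) : ℝ)) ∧
        ∀ e ∈ L, ((ratOf e.2 : ℚ) : ℝ) < m e.1 := by
  have hN : (0 : ℝ) < (N : ℝ) + 1 := by positivity
  have hval (L : List (ℕ × RatCode)) :
      ((ratOf (ratDivSucc (ratSum (L.map Prod.snd)) N) : ℚ) : ℝ) =
        (L.map fun e => ((ratOf e.2 : ℚ) : ℝ)).sum / ((N : ℝ) + 1) := by
    rw [ratOf_ratDivSucc, ratOf_ratSum]
    push_cast [Rat.cast_list_sum]
    simp [Function.comp_def]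
  have hrange (K : ℕ) (g : ℕ → ℝ) : ((List.range K).map g).sum = ∑ j ∈ Finset.range K, g j := by
    simp [Finset.sum, Finset.range, Multiset.range]
  constructor
  · rintro ⟨K, hK⟩
    rw [lt_div_iff₀ hN] at hK
    -- each term may be lowered by `δ`
    set δ := (∑ j ∈ Finset.range K, m j - q * ((N : ℝ) + 1)) / ((K : ℝ) + 1) with hδ
    have hδ0 : 0 < δ := div_pos (sub_pos.2 hK) (by positivity)
    choose c hc hc' using fun j => exists_ratOf_btwn (sub_lt_self (m j) hδ0)
    refine ⟨(List.range K).map fun j => (j, c j), ⟨by simp [Function.comp_def], ?_⟩, ?_⟩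
    · rw [hval, lt_div_iff₀ hN, List.map_map]
      refine lt_of_lt_of_le ?_ ((Finset.sum_le_sum fun j _ => (hc j).le).trans_eq
        (hrange K fun j => ((ratOf (c j) : ℚ) : ℝ)).symm)
      have hδK : δ * ((K : ℝ) + 1) = ∑ j ∈ Finset.range K, m j - q * ((N : ℝ) + 1) :=
        div_mul_cancel₀ _ (by positivity)
      rw [Finset.sum_sub_distrib, Finset.sum_const, Finset.card_range, nsmul_eq_mul]
      linarith
    · intro e he
      obtain ⟨j, -, rfl⟩ := List.mem_map.1 he
      exact hc' j
  · rintro ⟨L, ⟨hL, hq⟩, hm⟩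
    refine ⟨L.length, hq.trans_le ?_⟩
    rw [hval]
    gcongr
    rw [← hrange, ← hL, List.map_map]
    exact List.sum_le_sum fun e he => (hm e he).le

end Integral

section LowerSemicomputableIntegral

open ComputableMetricSpace

variable {X : Type*} [MetricSpace X] [ComputableMetricSpace X] [MeasurableSpace X] [BorelSpace X]
  {Z ι κ : Type*} [Primcodable ι] [Primcodable κ] {ν : ι → Set Z}

/-- Lower semicomputability, uniformly in a parameter `k`. -/
def UniformlyLSC {Y η : Type*} [Primcodable η] (ν : η → Set Y) (f : κ → Y → ℝ≥0∞) : Prop :=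
  UniformlyCEOpen ν fun a : κ × RatCode =>
    {y | (((ratOf a.2 : ℚ) : ℝ) : EReal) < (f a.1 y : EReal)}

theorem coe_lt_coe_ennreal_iff {q : ℝ} (hq : 0 ≤ q) (t : ℝ≥0∞) :
    (q : EReal) < (t : EReal) ↔ ENNReal.ofReal q < t := by
  rw [← EReal.coe_ennreal_lt_coe_ennreal_iff, EReal.coe_ennreal_ofReal, max_eq_left hq]

theorem coe_lt_coe_ennreal_of_neg {q : ℝ} (hq : q < 0) (t : ℝ≥0∞) : (q : EReal) < (t : EReal) :=
  (EReal.coe_neg'.2 hq).trans_le (EReal.coe_ennreal_nonneg t)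

theorem UniformlyLSC.measurable_section {f : κ → X × Z → ℝ≥0∞}
    (hf : UniformlyLSC (prodSubbasis (ballSubbasis X) ν) f) (k : κ) (z : Z) :
    Measurable fun x => f k (x, z) := by
  refine measurable_of_Ioi fun c => ?_
  have e : (fun x => f k (x, z)) ⁻¹' Set.Ioi c =
      ⋃ q ∈ {q : RatCode | (c : EReal) < (((ratOf q : ℚ) : ℝ) : EReal)},
        {x | (((ratOf q : ℚ) : ℝ) : EReal) < (f k (x, z) : EReal)} := by
    ext x
    simp only [Set.mem_preimage, Set.mem_Ioi, Set.mem_iUnion, Set.mem_ofPred_eq, exists_prop]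
    rw [← EReal.coe_ennreal_lt_coe_ennreal_iff]
    refine ⟨fun h => ?_, fun ⟨q, h1, h2⟩ => h1.trans h2⟩
    obtain ⟨q, h1, h2⟩ := EReal.lt_iff_exists_rat_btwn.1 h
    obtain ⟨q, rfl⟩ := exists_ratOf q
    exact ⟨q, h1, h2⟩
  rw [e]
  exact (isOpen_biUnion fun q _ => hf.isOpen_section (k, q) z).measurableSet

/-- The integral of a lower semicomputable function is lower semicomputable in the measure and the
parameter. -/
theorem UniformlyLSC.lintegral {f : κ → X × Z → ℝ≥0∞}
    (hf : UniformlyLSC (prodSubbasis (ballSubbasis X) ν) f) :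
    UniformlyLSC (prodSubbasis (measureSubbasis X) ν)
      fun k (p : ProbabilityMeasure X × Z) => ∫⁻ x, f k (x, p.2) ∂(p.1 : Measure X) := by
  -- the superlevel set at height `(j + 1) / (N + 1)` has measure above a rational bound
  have hlev : UniformlyCEOpen (prodSubbasis (measureSubbasis X) ν)
      fun a : ((κ × RatCode) × ℕ) × (ℕ × RatCode) => {p : ProbabilityMeasure X × Z |
        ((ratOf a.2.2 : ℚ) : ℝ) < (p.1 : Measure X).real {x | (x, p.2) ∈
          {y | (((ratOf (a.2.1 + 1, 0, a.1.2) : ℚ) : ℝ) : EReal) < (f a.1.1.1 y : EReal)}}} := by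
    have hp : Primrec fun a : ((κ × RatCode) × ℕ) × (ℕ × RatCode) =>
        ((a.1.1.1, ((a.2.1 + 1, 0, a.1.2) : RatCode)), a.2.2) :=
      .pair (.pair (Primrec.fst.comp (Primrec.fst.comp .fst))
        (.pair (Primrec.succ.comp (Primrec.fst.comp .snd)) (.pair (.const 0)
          (Primrec.snd.comp .fst)))) (Primrec.snd.comp .snd)
    have hr := (UniformlyCEOpen.lt_measureReal_section hf).reindex hp.to_comp
    exact hr
  have hsum : REPred fun c : ((κ × RatCode) × ℕ) × List (ℕ × RatCode) =>
      c.2.map Prod.fst = List.range c.2.length ∧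
        ratOf c.1.1.2 < ratOf (ratDivSucc (ratSum (c.2.map Prod.snd)) c.1.2) := by
    have hfst : Primrec fun m : List (ℕ × RatCode) => m.map Prod.fst :=
      Primrec.list_map .id (Primrec.fst.comp Primrec.snd)
    have hsnd : Primrec fun m : List (ℕ × RatCode) => ratSum (m.map Prod.snd) :=
      primrec_ratSum.comp (Primrec.list_map .id (Primrec.snd.comp Primrec.snd))
    refine .and (PrimrecPred.to_re (Primrec.eq.comp (hfst.comp .snd)
      (Primrec.list_range.comp (Primrec.list_length.comp .snd)))) (rePred_ratOf_lt ?_ ?_)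
    · exact Computable.snd.comp (Computable.fst.comp .fst)
    · exact (primrec_ratDivSucc.comp (hsnd.comp .snd) (Primrec.snd.comp .fst)).to_comp
  have hneg : REPred fun a : κ × RatCode => ratOf a.2 < ratOf (0, 0, 0) :=
    rePred_ratOf_lt .snd (.const _)
  refine ((uniformlyCEOpen_const hneg).union
    ((uniformlyCEOpen_const hsum).inter hlev.forall_mem_list).exists.exists).of_eq ?_
  rintro ⟨k, q⟩
  ext ⟨μ, z⟩
  have h0 : ratOf (0, 0, 0) = 0 := by simp [ratOf]
  simp only [Set.mem_ofPred_eq, h0]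
  rcases lt_or_ge (ratOf q) 0 with hq | hq
  · exact iff_of_true (.inl hq) (coe_lt_coe_ennreal_of_neg (by exact_mod_cast hq) _)
  · have hq' : (0 : ℝ) ≤ ((ratOf q : ℚ) : ℝ) := by exact_mod_cast hq
    rw [or_iff_right (not_lt.2 hq), coe_lt_coe_ennreal_iff hq',
      lt_lintegral_iff_exists_sum _ (hf.measurable_section k z) hq']
    refine exists_congr fun N => ?_
    rw [lt_sum_range_iff_exists_list]
    refine exists_congr fun L => and_congr (and_congr_right fun _ => Rat.cast_lt.symm)
      (forall₂_congr fun e _ => ?_)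
    have hthr (x : X) : (((ratOf (e.1 + 1, 0, N) : ℚ) : ℝ) : EReal) < (f k (x, z) : EReal) ↔
        ENNReal.ofReal (((e.1 : ℝ) + 1) / ((N : ℝ) + 1)) < f k (x, z) := by
      rw [ratOf_nat_div_succ, ← coe_lt_coe_ennreal_iff (by positivity)]
      push_cast
      rfl
    simp only [hthr]

end LowerSemicomputableIntegral

/-! ### Computability of the output distribution -/

section Push

variable {X Y : Type*} [MetricSpace X] [ComputableMetricSpace X] [MeasurableSpace X] [BorelSpace X]
  [MetricSpace Y] [ComputableMetricSpace Y] [MeasurableSpace Y] [BorelSpace Y]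

/-- The integrand by which both kinds of subbasic sets of measures are described through lower
bounds: `maxHat l` for the sets `{μ | μ f > r}`, and `1 - maxHat l` for the sets `{μ | μ f < r}`. -/
noncomputable def subbasisIntegrand (a : Bool × List (ℕ × RatCode × ℕ)) (y : Y) : ℝ≥0∞ :=
  ENNReal.ofReal (cond a.1 (1 - maxHat a.2 y) (maxHat a.2 y))

/-- The lower bound matching `subbasisIntegrand`: the code of `1 - r` or of `r`. -/
def subbasisBound (b : Bool) (r : RatCode) : RatCode :=
  cond b (ratAdd (1, 0, 0) (ratNeg r)) r

theorem ratOf_subbasisBound (b : Bool) (r : RatCode) :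
    ratOf (subbasisBound b r) = cond b (1 - ratOf r) (ratOf r) := by
  cases b
  · rfl
  · simp [subbasisBound, ratOf_ratAdd, ratOf_ratNeg, ratOf_nat, sub_eq_add_neg]

theorem primrec_subbasisBound : Primrec₂ subbasisBound :=
  Primrec.cond .fst (primrec_ratAdd.comp (.const _) (primrec_ratNeg.comp .snd)) .snd

theorem measurable_subbasisIntegrand (a : Bool × List (ℕ × RatCode × ℕ)) :
    Measurable (subbasisIntegrand a : Y → ℝ≥0∞) := by
  obtain ⟨b, l⟩ := a
  have h := (continuous_maxHat (X := Y) l).measurable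
  cases b
  · exact h.ennreal_ofReal
  · exact (h.const_sub 1).ennreal_ofReal

theorem mem_measureSubbasis_iff (b : Bool) (l : List (ℕ × RatCode × ℕ)) (r : RatCode)
    (μ : ProbabilityMeasure Y) :
    μ ∈ measureSubbasis Y (b, l, r) ↔ (((ratOf (subbasisBound b r) : ℚ) : ℝ) : EReal) <
      ((∫⁻ y, subbasisIntegrand (b, l) y ∂(μ : Measure Y) : ℝ≥0∞) : EReal) := by
  have hi := integrable_maxHat (μ : Measure Y) l
  have key {g : Y → ℝ} (hg : Integrable g (μ : Measure Y)) (h0 : ∀ y, 0 ≤ g y) (q : ℝ) :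
      (q : EReal) < ((∫⁻ y, ENNReal.ofReal (g y) ∂(μ : Measure Y) : ℝ≥0∞) : EReal) ↔
        q < ∫ y, g y ∂(μ : Measure Y) := by
    rw [← ofReal_integral_eq_lintegral_ofReal hg (.of_forall h0), EReal.coe_ennreal_ofReal,
      max_eq_left (integral_nonneg h0), EReal.coe_lt_coe_iff]
  rw [ratOf_subbasisBound]
  cases b
  · exact (key hi (maxHat_nonneg l) _).symm
  · have h1 : ∫ y, (1 - maxHat l y) ∂(μ : Measure Y) = 1 - ∫ y, maxHat l y ∂(μ : Measure Y) := by
      rw [integral_sub (integrable_const 1) hi]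
      simp
    refine Iff.trans ?_
      (key ((integrable_const 1).sub hi) (fun y => sub_nonneg.2 (maxHat_le_one l y)) _).symm
    simp only [Pi.sub_apply, h1, cond_true]
    push_cast
    change ∫ y, maxHat l y ∂(μ : Measure Y) < ((ratOf r : ℚ) : ℝ) ↔ _
    constructor <;> intro h <;> linarith

omit [MetricSpace X] [ComputableMetricSpace X] [BorelSpace X] [MetricSpace Y]
  [ComputableMetricSpace Y] [BorelSpace Y] in
theorem lintegral_pushKernel (Λ : Kernel X Y) [IsMarkovKernel Λ] (μ : ProbabilityMeasure X)
    {f : Y → ℝ≥0∞} (hf : Measurable f) :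
    ∫⁻ y, f y ∂(pushKernel Λ μ : Measure Y) = ∫⁻ x, ∫⁻ y, f y ∂(Λ x) ∂(μ : Measure X) :=
  Measure.lintegral_bind Λ.measurable.aemeasurable hf.aemeasurable

/-- The integrals of the subbasic integrands against `λ_x` are lower semicomputable in `x`, hence
so are their integrals over `μ`, which are the integrals against `Λ*μ`. -/
theorem computableMap_pushKernel {Λ : Kernel X Y} [IsMarkovKernel Λ]
    (hΛ : IsComputableKernel Λ) :
    ComputableMap (measureSubbasis X) (measureSubbasis Y) (pushKernel Λ) := by
  -- no parameter is needed here, so `μ` itself is used as one, along the diagonal map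
  have hF : UniformlyLSC (prodSubbasis (ballSubbasis X) (measureSubbasis X))
      fun (a : Bool × List (ℕ × RatCode × ℕ)) (p : X × ProbabilityMeasure X) =>
        ∫⁻ y, subbasisIntegrand a y ∂(Λ p.1) := by
    have hp : Primrec fun c : (Bool × List (ℕ × RatCode × ℕ)) × RatCode =>
        (c.1.1, c.1.2, subbasisBound c.1.1 c.2) :=
      .pair (Primrec.fst.comp .fst) (.pair (Primrec.snd.comp .fst)
        (primrec_subbasisBound.comp (Primrec.fst.comp .fst) .snd))
    have hfst : ComputableMap (prodSubbasis (ballSubbasis X) (measureSubbasis X))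
        (measureSubbasis Y) (kernelAt Λ ∘ Prod.fst) :=
      ComputableMap.comp hΛ computableMap_fst
    refine UniformlyCEOpen.of_eq (hfst.reindex hp.to_comp) ?_
    rintro ⟨⟨b, l⟩, s⟩
    ext p
    -- `r ↦ 1 - r` is an involution
    have hinv : ratOf (subbasisBound b (subbasisBound b s)) = ratOf s := by
      cases b <;> simp [ratOf_subbasisBound]
    rw [Set.mem_preimage, mem_measureSubbasis_iff, hinv]
    rfl
  have hdiag : ComputableMap (measureSubbasis X)
      (prodSubbasis (measureSubbasis X) (measureSubbasis X)) fun μ => (μ, μ) :=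
    computableMap_id.prodMk computableMap_id
  have hp : Primrec fun c : Bool × List (ℕ × RatCode × ℕ) × RatCode =>
      ((c.1, c.2.1), subbasisBound c.1 c.2.2) :=
    .pair (.pair .fst (Primrec.fst.comp .snd))
      (primrec_subbasisBound.comp .fst (Primrec.snd.comp .snd))
  refine ((hdiag.preimage hF.lintegral).reindex hp.to_comp).of_eq ?_
  rintro ⟨b, l, r⟩
  ext μ
  rw [Set.mem_preimage, Set.mem_preimage, mem_measureSubbasis_iff,
    lintegral_pushKernel Λ μ (measurable_subbasisIntegrand _)]
  rfl

end Push

/-! ### Computability of point masses -/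

section PointMass

open ComputableMetricSpace

variable {Y : Type*} [MetricSpace Y] [ComputableMetricSpace Y]

/-- The complement of a closed ball is a union of balls that lie formally outside of it. -/
theorem uniformlyCEOpen_lt_dist :
    UniformlyCEOpen (ballSubbasis Y) fun a : ℕ × RatCode =>
      {y | ((ratOf a.2 : ℚ) : ℝ) < dist y (pt a.1)} := by
  have hp : Primrec fun c : (ℕ × RatCode) × (ℕ × RatCode) =>
      ((c.2.1, c.1.1), ratAdd c.1.2 c.2.2) :=
    .pair (.pair (Primrec.fst.comp .snd) (Primrec.fst.comp .fst))
      (primrec_ratAdd.comp (Primrec.snd.comp .fst) (Primrec.snd.comp .snd))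
  have hd := (rePred_lt_dist Y).comp hp.to_comp
  refine ((uniformlyCEOpen_const hd).inter
    (uniformlyCEOpen_subbasis.reindex .snd)).exists.of_eq ?_
  rintro ⟨i, a⟩
  ext y
  simp only [Set.mem_ofPred_eq, ratOf_ratAdd]
  push_cast
  constructor
  · rintro ⟨⟨w, σ⟩, h1, h2⟩
    have h2' : dist y (pt w) < ((ratOf σ : ℚ) : ℝ) := h2
    have h3 := dist_triangle_left (pt w : Y) (pt i) y
    dsimp only at h1
    linarith
  · intro h
    obtain ⟨w, hw⟩ := (dense_pt (X := Y)).exists_dist_lt y (half_pos (sub_pos.2 h))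
    obtain ⟨σ, h1, h2⟩ := exists_ratOf_btwn hw
    refine ⟨(w, σ), ?_, h1⟩
    have h3 := dist_triangle y (pt w : Y) (pt i)
    dsimp only
    linarith

/-- The radius `ρ + (1 - r) / (n + 1)` of the ball on which a hat function exceeds the level `r` has
a code that is primitive recursive in the index of the hat function and in `r`. -/
theorem primrec_hatRadius : Primrec fun c : (ℕ × RatCode × ℕ) × RatCode =>
    ratAdd c.1.2.1 (ratDivSucc (ratAdd (1, 0, 0) (ratNeg c.2)) c.1.2.2) :=
  primrec_ratAdd.comp (Primrec.fst.comp (Primrec.snd.comp .fst))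
    (primrec_ratDivSucc.comp (primrec_ratAdd.comp (.const _) (primrec_ratNeg.comp .snd))
      (Primrec.snd.comp (Primrec.snd.comp .fst)))

theorem ratOf_hatRadius (ρ r : RatCode) (n : ℕ) :
    ((ratOf (ratAdd ρ (ratDivSucc (ratAdd (1, 0, 0) (ratNeg r)) n)) : ℚ) : ℝ) =
      (ratOf ρ : ℚ) + (1 - ((ratOf r : ℚ) : ℝ)) / ((n : ℝ) + 1) := by
  rw [ratOf_ratAdd, ratOf_ratDivSucc, ratOf_ratAdd, ratOf_ratNeg, ratOf_nat]
  push_cast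
  ring

theorem uniformlyCEOpen_lt_maxHat :
    UniformlyCEOpen (ballSubbasis Y) fun a : List (ℕ × RatCode × ℕ) × RatCode =>
      {y | ((ratOf a.2 : ℚ) : ℝ) < maxHat a.1 y} := by
  have hneg : REPred fun a : List (ℕ × RatCode × ℕ) × RatCode => ratOf a.2 < ratOf (0, 0, 0) :=
    rePred_ratOf_lt .snd (.const _)
  have hmem : REPred fun c : (List (ℕ × RatCode × ℕ) × RatCode) × (ℕ × RatCode × ℕ) =>
      (∃ p ∈ c.1.1, p = c.2) ∧ ratOf c.1.2 < ratOf (1, 0, 0) :=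
    .and (PrimrecPred.to_re ((PrimrecRel.exists_mem_list Primrec.eq).comp
      (Primrec.fst.comp .fst) .snd)) (rePred_ratOf_lt (Computable.snd.comp .fst) (.const _))
  have hr : Primrec fun c : (List (ℕ × RatCode × ℕ) × RatCode) × (ℕ × RatCode × ℕ) =>
      (c.2, c.1.2) := .pair .snd (Primrec.snd.comp .fst)
  have hb : Primrec fun c : (List (ℕ × RatCode × ℕ) × RatCode) × (ℕ × RatCode × ℕ) =>
      (c.2.1, ratAdd c.2.2.1 (ratDivSucc (ratAdd (1, 0, 0) (ratNeg c.1.2)) c.2.2.2)) :=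
    .pair (Primrec.fst.comp .snd) (primrec_hatRadius.comp hr)
  refine ((uniformlyCEOpen_const hneg).union ((uniformlyCEOpen_const hmem).inter
    (uniformlyCEOpen_subbasis.reindex hb.to_comp)).exists).of_eq ?_
  rintro ⟨l, r⟩
  ext y
  have hball (p : ℕ × RatCode × ℕ) : y ∈ ballSubbasis Y
      (p.1, ratAdd p.2.1 (ratDivSucc (ratAdd (1, 0, 0) (ratNeg r)) p.2.2)) ↔
        dist y (pt p.1) < (ratOf p.2.1 : ℚ) + (1 - ((ratOf r : ℚ) : ℝ)) / ((p.2.2 : ℝ) + 1) := by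
    rw [← ratOf_hatRadius]
    rfl
  simp only [Set.mem_ofPred_eq, ratOf_nat, exists_eq_right, hball]
  push_cast
  rcases lt_or_ge (ratOf r) 0 with h | h
  · exact iff_of_true (.inl h) ((Rat.cast_lt_zero.2 h).trans_le (maxHat_nonneg l y))
  · have h1 : ratOf r < 1 ↔ ((ratOf r : ℚ) : ℝ) < 1 := by norm_cast
    rw [or_iff_right (not_lt.2 h), lt_maxHat_iff l y (Rat.cast_nonneg.2 h)]
    refine exists_congr fun p => ?_
    rw [lt_hat_iff p y (Rat.cast_nonneg.2 h), and_assoc, h1]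

theorem uniformlyCEOpen_maxHat_lt :
    UniformlyCEOpen (ballSubbasis Y) fun a : List (ℕ × RatCode × ℕ) × RatCode =>
      {y | maxHat a.1 y < ((ratOf a.2 : ℚ) : ℝ)} := by
  have hpos : REPred fun a : List (ℕ × RatCode × ℕ) × RatCode => ratOf (0, 0, 0) < ratOf a.2 :=
    rePred_ratOf_lt (.const _) .snd
  have hone : REPred fun c : RatCode × (ℕ × RatCode × ℕ) => ratOf (1, 0, 0) < ratOf c.1 :=
    rePred_ratOf_lt (.const _) .fst
  have hr : Primrec fun c : RatCode × (ℕ × RatCode × ℕ) => (c.2, c.1) := .pair .snd .fst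
  have hb : Primrec fun c : RatCode × (ℕ × RatCode × ℕ) =>
      (c.2.1, ratAdd c.2.2.1 (ratDivSucc (ratAdd (1, 0, 0) (ratNeg c.1)) c.2.2.2)) :=
    .pair (Primrec.fst.comp .snd) (primrec_hatRadius.comp hr)
  have hall := ((uniformlyCEOpen_const hone).union
    ((uniformlyCEOpen_lt_dist (Y := Y)).reindex hb.to_comp)).forall_mem_list
  have hswap : Primrec fun a : List (ℕ × RatCode × ℕ) × RatCode => (a.2, a.1) := .pair .snd .fst
  have hall' := hall.reindex hswap.to_comp
  refine ((uniformlyCEOpen_const hpos).inter hall').of_eq ?_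
  rintro ⟨l, r⟩
  ext y
  simp only [Set.mem_ofPred_eq, ratOf_nat, ratOf_hatRadius, maxHat_lt_iff, hat_lt_iff]
  have h0 : ((0 : ℕ) : ℚ) < ratOf r ↔ (0 : ℝ) < ((ratOf r : ℚ) : ℝ) := by
    rw [Nat.cast_zero, Rat.cast_pos]
  have h1 : ((1 : ℕ) : ℚ) < ratOf r ↔ (1 : ℝ) < ((ratOf r : ℚ) : ℝ) := by
    rw [Nat.cast_one, ← Rat.cast_one (α := ℝ), Rat.cast_lt]
  rw [h0, h1]
  exact and_congr_right fun h => forall₂_congr fun p _ => (and_iff_right h).symm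

variable {X : Type*} [MetricSpace X] [ComputableMetricSpace X] [MeasurableSpace X] [BorelSpace X]
  [MeasurableSpace Y] [BorelSpace Y]

/-- A computable point map, viewed as a deterministic kernel, is a computable kernel: the maxima of
hat functions are computable real functions. -/
theorem IsComputablePointMap.isComputableKernel_deterministic {h : X → Y}
    (hh : IsComputablePointMap h) :
    IsComputableKernel (Kernel.deterministic h hh.continuous.measurable) := by
  have ht : REPred fun c : Bool × List (ℕ × RatCode × ℕ) × RatCode => c.1 = true :=
    PrimrecPred.to_re (Primrec.eq.comp .fst (.const true))
  have hf : REPred fun c : Bool × List (ℕ × RatCode × ℕ) × RatCode => c.1 = false :=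
    PrimrecPred.to_re (Primrec.eq.comp .fst (.const false))
  have hY := ((uniformlyCEOpen_const ht).inter
    ((uniformlyCEOpen_maxHat_lt (Y := Y)).reindex .snd)).union
    ((uniformlyCEOpen_const hf).inter ((uniformlyCEOpen_lt_maxHat (Y := Y)).reindex .snd))
  refine (ComputableMap.preimage hh hY).of_eq ?_
  rintro ⟨b, l, r⟩
  ext x
  have hint : ∫ y, maxHat l y ∂((kernelAt (Kernel.deterministic h hh.continuous.measurable) x :
      ProbabilityMeasure Y) : Measure Y) = maxHat l (h x) := by
    change ∫ y, maxHat l y ∂(Kernel.deterministic h hh.continuous.measurable x) = _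
    rw [Kernel.deterministic_apply, integral_dirac]
  cases b
  · simp [measureSubbasis, hint]
  · simp [measureSubbasis, hint]

end PointMass

/-! ### Conservation of randomness -/

section Conservation

variable {X Y : Type*} [MetricSpace X] [ComputableMetricSpace X] [MeasurableSpace X] [BorelSpace X]
  [MetricSpace Y] [ComputableMetricSpace Y] [MeasurableSpace Y] [BorelSpace Y]

omit [BorelSpace Y] in
theorem IsUniformTest.uniformlyLSC {t : Y × ProbabilityMeasure Y → ℝ≥0∞} (ht : IsUniformTest t) :
    UniformlyLSC (prodSubbasis (ballSubbasis Y) (measureSubbasis Y)) fun _ : Unit => t :=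
  UniformlyCEOpen.reindex ht.1 .snd

theorem IsUniformTest.measurable {t : Y × ProbabilityMeasure Y → ℝ≥0∞} (ht : IsUniformTest t)
    (ν : ProbabilityMeasure Y) : Measurable fun y => t (y, ν) :=
  ht.uniformlyLSC.measurable_section () ν

/-- Averaging a uniform test over a computable kernel gives a uniform test on the source space. -/
theorem IsUniformTest.lintegral_kernel {t : Y × ProbabilityMeasure Y → ℝ≥0∞}
    (ht : IsUniformTest t) {Λ : Kernel X Y} [IsMarkovKernel Λ] (hΛ : IsComputableKernel Λ) :
    IsUniformTest fun p : X × ProbabilityMeasure X => ∫⁻ y, t (y, pushKernel Λ p.2) ∂(Λ p.1) := by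
  constructor
  · have hmap : ComputableMap (prodSubbasis (ballSubbasis X) (measureSubbasis X))
        (prodSubbasis (measureSubbasis Y) (measureSubbasis Y))
        fun p => (kernelAt Λ p.1, pushKernel Λ p.2) :=
      (ComputableMap.comp hΛ computableMap_fst).prodMk
        ((computableMap_pushKernel hΛ).comp computableMap_snd)
    have h := (hmap.preimage ht.uniformlyLSC.lintegral).reindex
      (Computable.pair (.const ()) .id : Computable fun q : RatCode => ((), q))
    exact h
  · intro μ
    exact (lintegral_pushKernel Λ μ (ht.measurable _)).symm.trans_le (ht.2 _)

theorem IsUniversalTest.exists_lintegral_le {t₁ : X × ProbabilityMeasure X → ℝ≥0∞}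
    (ht₁ : IsUniversalTest t₁) {t₀ : Y × ProbabilityMeasure Y → ℝ≥0∞} (ht₀ : IsUniformTest t₀)
    {Λ : Kernel X Y} [IsMarkovKernel Λ] (hΛ : IsComputableKernel Λ) :
    ∃ c : ℝ≥0, 0 < c ∧ ∀ (μ : ProbabilityMeasure X) (x : X),
      ∫⁻ y, t₀ (y, pushKernel Λ μ) ∂(Λ x) ≤ (c : ℝ≥0∞) * t₁ (x, μ) := by
  obtain ⟨c, hc, h⟩ := ht₁.2 _ (ht₀.lintegral_kernel hΛ)
  exact ⟨c, hc, fun μ x => h x μ⟩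

theorem log_div_log_two_strictMono :
    StrictMono fun t : ℝ≥0∞ => ENNReal.log t / ((Real.log 2 : ℝ) : EReal) := fun _ _ h =>
  EReal.div_lt_div_right_of_pos (EReal.coe_pos.2 (Real.log_pos one_lt_two)) (EReal.coe_ne_top _)
    (ENNReal.log_lt_log h)

theorem log_mul_div_log_two {c : ℝ≥0} (hc : 0 < c) (t : ℝ≥0∞) :
    ENNReal.log (c * t) / ((Real.log 2 : ℝ) : EReal) =
      ENNReal.log t / ((Real.log 2 : ℝ) : EReal) + (Real.logb 2 c : ℝ) := by
  rw [ENNReal.log_mul_add, EReal.add_div_of_nonneg_right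
    (EReal.coe_nonneg.2 (Real.log_pos one_lt_two).le), add_comm, ENNReal.log_of_nnreal hc.ne',
    ← EReal.coe_div]
  rfl

end Conservation

end UniformRandomness

open UniformRandomness in
theorem mainTheorem7
    {X₁ X₀ : Type*}
    [MetricSpace X₁] [CompleteSpace X₁] [UniformRandomness.ComputableMetricSpace X₁]
    [MeasurableSpace X₁] [BorelSpace X₁]
    [MetricSpace X₀] [CompleteSpace X₀] [UniformRandomness.ComputableMetricSpace X₀]
    [MeasurableSpace X₀] [BorelSpace X₀]
    (t₁ : X₁ × ProbabilityMeasure X₁ → ℝ≥0∞) (ht₁ : UniformRandomness.IsUniversalTest t₁)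
    (t₀ : X₀ × ProbabilityMeasure X₀ → ℝ≥0∞) (ht₀ : UniformRandomness.IsUniversalTest t₀) :
    (∀ (Λ : Kernel X₁ X₀) [IsMarkovKernel Λ], UniformRandomness.IsComputableKernel Λ →
      ∃ c : ℝ≥0, ∀ (μ : ProbabilityMeasure X₁) (x : X₁),
        ∫⁻ y, t₀ (y, UniformRandomness.pushKernel Λ μ) ∂(Λ x) ≤ (c : ℝ≥0∞) * t₁ (x, μ)) ∧
    (∀ (h : X₁ → X₀) (hh : UniformRandomness.IsComputablePointMap h),
      ∃ c : ℝ, ∀ (μ : ProbabilityMeasure X₁) (x : X₁),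
        UniformRandomness.deficiency t₀ (UniformRandomness.pushMap h hh μ) (h x)
          ≤ UniformRandomness.deficiency t₁ μ x + (c : EReal)) ∧
    (∀ (Λ : Kernel X₁ X₀) [IsMarkovKernel Λ], UniformRandomness.IsComputableKernel Λ →
      ∃ c : ℝ, ∀ (μ : ProbabilityMeasure X₁) (x : X₁) (m : ℕ), 0 < m →
        Λ x {y | UniformRandomness.deficiency t₁ μ x + ((m : ℝ) : EReal) + (c : EReal)
            < UniformRandomness.deficiency t₀ (UniformRandomness.pushKernel Λ μ) y}
          ≤ (2 : ℝ≥0∞)⁻¹ ^ m) := by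
  refine ⟨fun Λ _ hΛ => ?_, fun h hh => ?_, fun Λ _ hΛ => ?_⟩
  · obtain ⟨c, -, hc⟩ := ht₁.exists_lintegral_le ht₀.1 hΛ
    exact ⟨c, hc⟩
  · obtain ⟨c, hc0, hc⟩ := ht₁.exists_lintegral_le ht₀.1 hh.isComputableKernel_deterministic
    refine ⟨Real.logb 2 c, fun μ x => ?_⟩
    have hpush : pushKernel (Kernel.deterministic h hh.continuous.measurable) μ =
        pushMap h hh μ := Subtype.ext (Measure.bind_dirac_eq_map _ hh.continuous.measurable)
    have hcx := hc μ x
    rw [Kernel.lintegral_deterministic, hpush] at hcx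
    rw [deficiency, deficiency, ← log_mul_div_log_two hc0]
    exact log_div_log_two_strictMono.monotone hcx
  · obtain ⟨c, hc0, hc⟩ := ht₁.exists_lintegral_le ht₀.1 hΛ
    refine ⟨Real.logb 2 c, fun μ x m _ => ?_⟩
    -- on the set in question the test exceeds `A = 2 ^ m * c * t₁ (x, μ)`
    set A : ℝ≥0∞ := ((2 ^ m * c : ℝ≥0) : ℝ≥0∞) * t₁ (x, μ) with hA
    have hset : {y | deficiency t₁ μ x + ((m : ℝ) : EReal) + ((Real.logb 2 c : ℝ) : EReal)
        < deficiency t₀ (pushKernel Λ μ) y} = {y | A < t₀ (y, pushKernel Λ μ)} := by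
      ext y
      have hlog : Real.logb 2 ((2 ^ m * c : ℝ≥0) : ℝ) = (m : ℝ) + Real.logb 2 c := by
        push_cast
        rw [Real.logb_mul (by positivity) (by exact_mod_cast hc0.ne'), Real.logb_pow,
          Real.logb_self_eq_one one_lt_two, mul_one]
      have hdef : deficiency t₁ μ x + ((m : ℝ) : EReal) + ((Real.logb 2 c : ℝ) : EReal) =
          ENNReal.log A / ((Real.log 2 : ℝ) : EReal) := by
        rw [hA, log_mul_div_log_two (by positivity), hlog, EReal.coe_add, ← add_assoc, deficiency]
      rw [Set.mem_ofPred_eq, hdef]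
      exact log_div_log_two_strictMono.lt_iff_lt
    rw [hset]
    have hAc : (2 : ℝ≥0∞)⁻¹ ^ m * A = c * t₁ (x, μ) := by
      rw [hA, ENNReal.coe_mul, ← mul_assoc, ← mul_assoc, ENNReal.coe_pow, ENNReal.coe_ofNat,
        ← mul_pow, ENNReal.inv_mul_cancel two_ne_zero ENNReal.ofNat_ne_top, one_pow, one_mul]
    have hint := hc μ x
    rw [← hAc] at hint
    have hmeas := ht₀.1.measurable (pushKernel Λ μ)
    rcases eq_or_ne A 0 with h0 | h0
    · -- the test vanishes almost everywhere
      rw [h0, mul_zero, nonpos_iff_eq_zero, lintegral_eq_zero_iff hmeas] at hint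
      have hnull : Λ x {y | A < t₀ (y, pushKernel Λ μ)} = 0 := by
        refine measure_mono_null (fun y hy => ?_) (ae_iff.1 hint)
        rw [Set.mem_ofPred_eq, h0] at hy
        exact hy.ne'
      rw [hnull]
      exact zero_le
    rcases eq_or_ne A ⊤ with ht | ht
    · simp [ht]
    · have hM := (mul_meas_ge_le_lintegral (μ := Λ x) hmeas A).trans hint
      rw [mul_comm, ENNReal.mul_le_mul_iff_left h0 ht] at hM
      have hsub : {y | A < t₀ (y, pushKernel Λ μ)} ⊆ {y | A ≤ t₀ (y, pushKernel Λ μ)} :=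
        fun y hy => le_of_lt (show A < t₀ (y, pushKernel Λ μ) from hy)
      exact (measure_mono hsub).trans hM
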